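/- **Conventions.** For a partition $\lambda=(\lambda_1\ge\lambda_2\ge\dots)$ (possibly empty, in which case $\lambda_1=0$) write $|\lambda|=\sum_i\lambda_i$. For $n\ge|\lambda|+\lambda_1$ let $\lambda[n]=(n-|\lambda|,\lambda_1,\lambda_2,\dots)$, a partition of $n$. For an integer $k\ge 0$, $(k)$ denotes the partition with the single part $k$ (the empty partition if $k=0$). Let $\mathfrak S_n(\lambda)$ be the irreducible complex representation (Specht module) of the symmetric group $\mathfrak S_n$ indexed by the partition $\lambda$ of $n$. For partitions $\lambda,\mu,\nu$ with $|\lambda|=l$, $|\mu|=m$ and $|\nu|=l+m$, the Littlewood–Richardson coefficient is the multiplicity $$c^\nu_{\lambda,\mu}=\bigl[\operatorname{Ind}_{\mathfrak S_l\times\mathfrak S_m}^{\mathfrak S_{l+m}}\mathfrak S_l(\lambda)\otimes\mathfrak S_m(\mu),\ \mathfrak S_{l+m}(\nu)\bigr]=\dim\operatorname{Hom}_{\mathfrak S_{l+m}}\bigl(\operatorname{Ind}_{\mathfrak S_l\times\mathfrak S_m}^{\mathfrak S_{l+m}}\mathfrak S_l(\lambda)\otimes\mathfrak S_m(\mu),\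 \mathfrak S_{l+m}(\nu)\bigr).$$ If $|\nu|\ne|\lambda|+|\mu|$, then $c^\nu_{\lambda,\mu}=0$; likewise, $c^\nu_{\lambda,(k)}=0$ for $k<0$. **Lemma.** Let $\lambda,\xi$ be partitions and let $n\ge0$ be an integer. (a) If $n\ge|\lambda|+\lambda_1$ and $c^{\lambda[n]}_{\xi,(n-|\xi|)}=1$, then $c^{\xi}_{\lambda,(|\xi|-|\lambda|)}=1$. (b) If $n\ge|\lambda|+\xi_1$ and $c^{\xi}_{\lambda,(|\xi|-|\lambda|)}=1$, then $n\ge|\lambda|+\lambda_1$ (so that $\lambda[n]$ is a partition) and $c^{\lambda[n]}_{\xi,(n-|\xi|)}=1$. (c) If $n\ge|\lambda|+\xi_1$ and $n\ge|\lambda|+\lambda_1$, then $c^{\xi}_{\lambda,(|\xi|-|\lambda|)}=c^{\lambda[n]}_{\xi,(n-|\xi|)}$. -/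

import Mathlib

open scoped MonoidAlgebra TensorProduct

noncomputable section

namespace LRFlip

/-! ### Partitions

Partitions are Mathlib's `YoungDiagram`s: `μ.card` is `|μ|`, and `μ.rowLen i` is the `(i+1)`-st part
of `μ`, which is `0` when `μ` has at most `i` parts. -/

/-- The partition `(k)` with the single part `k`; it is the empty partition for `k = 0`. -/
def oneRow (k : ℕ) : YoungDiagram :=
  YoungDiagram.ofRowLens [k] (List.pairwise_singleton _ k).sortedGE

theorem padded_sortedGE (lam : YoungDiagram) (n : ℕ) (h : lam.card + lam.rowLen 0 ≤ n) :
    ((n - lam.card) :: lam.rowLens).SortedGE := by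
  refine (List.pairwise_cons.2 ⟨fun b hb => ?_, lam.rowLens_sorted.pairwise⟩).sortedGE
  simp only [YoungDiagram.rowLens, List.mem_map] at hb
  obtain ⟨i, -, rfl⟩ := hb
  have := lam.rowLen_anti 0 i (Nat.zero_le i)
  omega

/-- The partition `λ[n] = (n - |λ|, λ₁, λ₂, …)`, for `n ≥ |λ| + λ₁`. -/
def padded (lam : YoungDiagram) (n : ℕ) (h : lam.card + lam.rowLen 0 ≤ n) : YoungDiagram :=
  YoungDiagram.ofRowLens ((n - lam.card) :: lam.rowLens) (padded_sortedGE lam n h)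

/-! ### Specht modules -/

section Specht

variable (α : Type) (lam : YoungDiagram)

/-- A `lam`-tableau with entries in `α`: a bijection from `α` to the cells of `lam`, sending an
entry to the cell `(row, column)` which contains it. There is none if `α` does not have exactly
`|lam|` elements. -/
abbrev Tableau : Type := α ≃ lam.cells

/-- A `lam`-tabloid with entries in `α`, i.e. a `lam`-tableau up to permutations of the entries
within each row: it is given by the row that contains each entry, where the `i`-th row
has `lam.rowLen i` entries. -/
def Tabloid : Type := {f : α → ℕ // ∀ i, Nat.card {a // f a = i} = lam.rowLen i}

variable {α lam}

/-- A permutation acts on a tabloid by permuting its entries. -/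
instance : MulAction (Equiv.Perm α) (Tabloid α lam) where
  smul σ f := ⟨fun a => f.1 (σ⁻¹ a), fun i => by
    rw [← f.2 i]
    exact Nat.card_congr (σ⁻¹.subtypeEquiv fun a => Iff.rfl)⟩
  one_smul _ := rfl
  mul_smul _ _ _ := rfl

/-- The tabloid `{t}` of a tableau `t`. -/
def Tableau.tabloid (t : Tableau α lam) : Tabloid α lam :=
  ⟨fun a => (t a).1.1, fun i => by
    rw [YoungDiagram.rowLen_eq_card, ← Nat.card_eq_finsetCard]
    have e : {c : lam.cells // c.1.1 = i} ≃ lam.row i :=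
      { toFun := fun c => ⟨c.1.1, YoungDiagram.mem_row_iff.2 ⟨c.1.2, c.2⟩⟩
        invFun := fun c => ⟨⟨c.1, (YoungDiagram.mem_row_iff.1 c.2).1⟩,
          (YoungDiagram.mem_row_iff.1 c.2).2⟩
        left_inv := fun _ => rfl
        right_inv := fun _ => rfl }
    exact Nat.card_congr ((t.subtypeEquiv fun _ => Iff.rfl).trans e)⟩

/-- `σ` lies in the column stabiliser of `t`: it preserves each column of `t`. -/
def Tableau.IsColumnPerm (t : Tableau α lam) (σ : Equiv.Perm α) : Prop :=
  ∀ a, (t (σ a)).1.2 = (t a).1.2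

instance [Fintype α] (t : Tableau α lam) : DecidablePred t.IsColumnPerm := fun _ =>
  inferInstanceAs (Decidable (∀ _, _))

variable [Fintype α] [DecidableEq α]

/-- The polytabloid `e_t = ∑ sgn(σ) σ{t}`, the sum over the column stabiliser of `t`. -/
def Tableau.polytabloid (t : Tableau α lam) : ℂ[Tabloid α lam] :=
  ∑ σ : Equiv.Perm α with t.IsColumnPerm σ,
    MonoidAlgebra.single (σ • t.tabloid) ((Equiv.Perm.sign σ : ℤ) : ℂ)

/-- Permuting the entries of `t` by `τ` permutes its polytabloid by `τ`. -/
theorem Tableau.smul_polytabloid (τ : Equiv.Perm α) (t : Tableau α lam) :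
    Representation.ofMulAction ℂ (Equiv.Perm α) (Tabloid α lam) τ t.polytabloid
      = Tableau.polytabloid (τ⁻¹.trans t : Tableau α lam) := by
  have key : ∀ σ : Equiv.Perm α,
      Tableau.IsColumnPerm (τ⁻¹.trans t : Tableau α lam) (τ * σ * τ⁻¹) ↔ t.IsColumnPerm σ := by
    intro σ
    refine (τ⁻¹).forall_congr fun {a} => ?_
    simp [Equiv.Perm.mul_apply]
  have htab : Tableau.tabloid (τ⁻¹.trans t : Tableau α lam) = τ • t.tabloid := rfl
  simp only [Tableau.polytabloid, map_sum, Representation.ofMulAction_single, htab]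
  refine Finset.sum_equiv (MulAut.conj τ).toEquiv (fun σ => ?_) (fun σ _ => ?_)
  · simp [key]
  · have hs : ((Equiv.Perm.sign τ : ℤ) : ℂ) * ((Equiv.Perm.sign τ : ℤ) : ℂ) = 1 := by
      rw [← Int.cast_mul, ← Units.val_mul, Int.units_mul_self]; simp
    simp [smul_smul, mul_comm]
    rw [← mul_assoc, hs, one_mul]

variable (α lam)

/-- The Specht module, as a subrepresentation of the permutation representation of the symmetric
group of `α` on the `lam`-tabloids: it is spanned by the polytabloids. -/
def spechtSub : Subrepresentation
    (Representation.ofMulAction ℂ (Equiv.Perm α) (Tabloid α lam)) where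
  toSubmodule := Submodule.span ℂ (Set.range fun t : Tableau α lam => t.polytabloid)
  apply_mem_toSubmodule τ v hv := by
    induction hv using Submodule.span_induction with
    | mem x hx =>
      obtain ⟨t, rfl⟩ := hx
      exact Submodule.subset_span ⟨_, (t.smul_polytabloid τ).symm⟩
    | zero => simp
    | add x y _ _ hx hy => rw [map_add]; exact Submodule.add_mem _ hx hy
    | smul c x _ hx => rw [map_smul]; exact Submodule.smul_mem _ _ hx

/-- The underlying complex vector space of the Specht module. -/
abbrev SpechtModule : Type := (spechtSub α lam).toSubmodule

/-- The Specht module of `lam` as a complex representation of the symmetric group of `α`. It is the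
irreducible representation indexed by `lam` if `α` has `|lam|` elements, and zero otherwise (there
are no `lam`-tableaux with entries in `α` then). -/
def specht : Representation ℂ (Equiv.Perm α) (SpechtModule α lam) :=
  (spechtSub α lam).toRepresentation

end Specht

/-! ### Littlewood–Richardson coefficients -/

/-- The Young subgroup `𝔖_l × 𝔖_m` of `𝔖_{l+m}`: the first factor permutes the first `l` letters and
the second one permutes the last `m` letters. -/
def youngEmbedding (l m : ℕ) :
    Equiv.Perm (Fin l) × Equiv.Perm (Fin m) →* Equiv.Perm (Fin (l + m)) :=
  (finSumFinEquiv (m := l) (n := m)).permCongrHom.toMonoidHom.comp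
    (Equiv.Perm.sumCongrHom (Fin l) (Fin m))

/-- The external tensor product of representations of `G` and `H`, a representation of `G × H`. -/
def extTensor {G H V W : Type} [Group G] [Group H] [AddCommGroup V] [Module ℂ V]
    [AddCommGroup W] [Module ℂ W] (ρ : Representation ℂ G V) (σ : Representation ℂ H W) :
    Representation ℂ (G × H) (V ⊗[ℂ] W) :=
  Representation.tprod (ρ.comp (MonoidHom.fst G H)) (σ.comp (MonoidHom.snd G H))

/-- The multiplicity `[V, W]` of an irreducible complex representation `W` in a finite-dimensional
complex representation `V` of a finite group, as `dim Hom_G(V, W)`. -/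
def multiplicity {G V W : Type} [Group G] [AddCommGroup V] [Module ℂ V]
    [AddCommGroup W] [Module ℂ W] (ρ : Representation ℂ G V) (σ : Representation ℂ G W) : ℕ :=
  Module.finrank ℂ (Representation.IntertwiningMap ρ σ)

/-- The Littlewood–Richardson coefficient `c^ν_{λ,μ}`: with `l = |λ|` and `m = |μ|`, the multiplicity
of the Specht module of `ν` in the representation of `𝔖_{l+m}` induced from the representation
`𝔖_l(λ) ⊗ 𝔖_m(μ)` of `𝔖_l × 𝔖_m`. If `|ν| ≠ l + m`, the Specht module of `ν` over
`𝔖_{l+m}` is zero, and so is `c^ν_{λ,μ}`. -/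
def lrCoeff (nu lam mu : YoungDiagram) : ℕ :=
  multiplicity
    (Representation.ind (youngEmbedding lam.card mu.card)
      (extTensor (specht (Fin lam.card) lam) (specht (Fin mu.card) mu)))
    (specht (Fin (lam.card + mu.card)) nu)

/-- The coefficient vanishes if the sizes do not add up. -/
theorem lrCoeff_eq_zero (nu lam mu : YoungDiagram) (h : lam.card + mu.card ≠ nu.card) :
    lrCoeff nu lam mu = 0 := by
  have : IsEmpty (Tableau (Fin (lam.card + mu.card)) nu) :=
    ⟨fun t => h (by simpa using Fintype.card_congr t)⟩
  have hS : Subsingleton (SpechtModule (Fin (lam.card + mu.card)) nu) := by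
    rw [Submodule.subsingleton_iff_eq_bot]
    simp [spechtSub]
  have : Subsingleton (Representation.IntertwiningMap
      (Representation.ind (youngEmbedding lam.card mu.card)
        (extTensor (specht (Fin lam.card) lam) (specht (Fin mu.card) mu)))
      (specht (Fin (lam.card + mu.card)) nu)) :=
    ⟨fun f g => DFunLike.ext f g fun x => Subsingleton.elim _ _⟩
  exact Module.finrank_zero_of_subsingleton

end LRFlip

end

/-!
By Pieri's rule, `c^ν_{λ,(k)}` with `k = |ν| - |λ|` is `1` if `ν / λ` is a horizontal strip, that is,
`ν_{i+1} ≤ λ_i ≤ ν_i` for all `i`, and `0` otherwise (`lrCoeff_oneRow`). The first part of `λ[n]` is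
`n - |λ|` and its `(i+1)`-st part is the `i`-th part of `λ`. So the inequalities saying that
`λ[n] / ξ` is a horizontal strip are those saying that `ξ / λ` is one, together with
`ξ_1 ≤ n - |λ|` (`isHorizontalStrip_padded_iff`), and all three claims follow.

Pieri's rule is proved with characters. For a permutation `g` of `α`, let `p_g` be the power sum
symmetric polynomial of its cycle type, in `N` variables; it is the sum of the monomials of all
labellings of `α` by the variables that `g` fixes, and its coefficients are the characters of the
permutation modules on tabloids of given content. Burnside's lemma evaluates `∑_g p_g` and
`∑_g ψ(g) p_g`, for the character `ψ` of such a permutation module, in terms of complete homogeneous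
polynomials (`sum_permPoly`, `sum_fixedCount_mul_permPoly`).

Let `θ_λ(g)` be the coefficient of `x^(λ+δ)` in `a_δ p_g`, where `a_e = det (x_k ^ e_i)` and `δ` is
the staircase. This is an alternating sum of permutation characters, and the Jacobi–Trudi identity
(`alternant_eq_det_mul`) turns the Burnside count into `a_δ ∑_g θ_λ(g) p_g = n! a_{λ+δ}`
(`alternant_stair_mul_sum_frobeniusChar`). In particular `θ_λ` has norm one. The character `χ_λ` of
the Specht module has norm one as well, and its scalar product with `θ_λ` is one: of the permutation
modules that occur in `θ_λ`, only the module of `λ`-tabloids contains the Specht module, and it does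
so once. This rests on the usual fact that the column stabiliser of a tableau `t` acts by signs on
the image of the polytabloid of `t`, so that this image is supported on tabloids that are injective
on the columns of `t`; comparing the sums of the row labels (`Tableau.row_weight`) then leaves only
the tabloids `σ{t}` with `σ` in the column stabiliser. Hence `χ_λ = θ_λ` (`Tableau.character_specht`).

By Frobenius reciprocity, `c^ν_{λ,(m)}` is now the coefficient of `x^(ν+δ)` in `a_{λ+δ} h_m`, which
is a determinant of zeros and ones comparing the entries of `λ + δ` and `ν + δ`
(`det_comparison`).
-/

noncomputable section

open scoped MonoidAlgebra TensorProduct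

namespace LRFlip

/-! ### Labellings, Burnside's count, and power sums -/

section Content

variable {α κ : Type} [Fintype α]

/-- The content of a labelling `F : α → κ`: the number of letters carrying each label. -/
def content (F : α → κ) : κ →₀ ℕ := ∑ a, Finsupp.single (F a) 1

theorem content_apply [DecidableEq κ] (F : α → κ) (i : κ) :
    content F i = Fintype.card {a // F a = i} := by
  rw [content, Finsupp.finsetSum_apply, Fintype.card_subtype, Finset.card_filter]
  exact Finset.sum_congr rfl fun a _ => by rw [Finsupp.single_apply]

theorem content_comp_perm (F : α → κ) (σ : Equiv.Perm α) :
    content (fun a => F (σ a)) = content F :=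
  Equiv.sum_comp σ fun a => Finsupp.single (F a) 1

theorem content_mem_finsuppAntidiag [Fintype κ] [DecidableEq κ] (F : α → κ) :
    content F ∈ Finset.finsuppAntidiag Finset.univ (Fintype.card α) := by
  rw [Finset.mem_finsuppAntidiag]
  refine ⟨?_, Finset.subset_univ _⟩
  simp only [content_apply]
  rw [← Fintype.card_sigma]
  exact Fintype.card_congr (Equiv.sigmaFiberEquiv F)

variable (α) in
/-- The labellings of `α` of content `c`; these are the tabloids of the composition `c`. -/
abbrev Fill (c : κ →₀ ℕ) : Type := {F : α → κ // content F = c}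

/-- A permutation acts on a labelling by permuting the letters. -/
instance (c : κ →₀ ℕ) : MulAction (Equiv.Perm α) (Fill α c) where
  smul σ F := ⟨fun a => F.1 (σ⁻¹ a), (content_comp_perm F.1 σ⁻¹).trans F.2⟩
  one_smul _ := rfl
  mul_smul _ _ _ := rfl

theorem Fill.smul_apply {c : κ →₀ ℕ} (σ : Equiv.Perm α) (F : Fill α c) (a : α) :
    (σ • F).1 a = F.1 (σ⁻¹ a) := rfl

theorem Fill.smul_eq_self_iff {c : κ →₀ ℕ} (σ : Equiv.Perm α) (F : Fill α c) :
    σ • F = F ↔ ∀ a, F.1 (σ a) = F.1 a := by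
  rw [Subtype.ext_iff, funext_iff, ← σ.forall_congr_right]
  refine forall_congr' fun a => ?_
  rw [smul_apply, show σ⁻¹ (σ a) = a from σ.symm_apply_apply a, eq_comm]

/-- Labellings with the same content are related by a permutation of the letters. -/
theorem Fill.exists_smul_eq [DecidableEq κ] {c : κ →₀ ℕ} (F F' : Fill α c) :
    ∃ σ : Equiv.Perm α, σ • F = F' := by
  have h : ∀ i, Nonempty ({a // F'.1 a = i} ≃ {a // F.1 a = i}) := fun i =>
    ⟨Fintype.equivOfCardEq (by rw [← content_apply, ← content_apply, F.2, F'.2])⟩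
  let τ : Equiv.Perm α := (Equiv.sigmaFiberEquiv F'.1).symm.trans
    ((Equiv.sigmaCongrRight fun i => (h i).some).trans (Equiv.sigmaFiberEquiv F.1))
  refine ⟨τ⁻¹, Subtype.ext (funext fun a => ?_)⟩
  rw [smul_apply, inv_inv]
  exact ((h (F'.1 a)).some ⟨a, rfl⟩).2

theorem Fill.nonempty [Fintype κ] [DecidableEq κ] {c : κ →₀ ℕ}
    (h : c ∈ Finset.finsuppAntidiag Finset.univ (Fintype.card α)) : Nonempty (Fill α c) := by
  rw [Finset.mem_finsuppAntidiag] at h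
  have e : α ≃ Σ i, Fin (c i) := Fintype.equivOfCardEq (by simp [Fintype.card_sigma, h.1])
  refine ⟨⟨fun a => (e a).1, Finsupp.ext fun i => ?_⟩⟩
  rw [content_apply, ← Fintype.card_fin (c i)]
  refine Fintype.card_congr ((e.subtypeEquiv (q := fun x => x.1 = i) fun a => Iff.rfl).trans
    (Equiv.sigmaSubtype i))

variable [DecidableEq α] [Fintype κ] [DecidableEq κ]

/-- The number of labellings of content `c` that `g` fixes: the character of the permutation
representation on the labellings of content `c`. -/
def fixedCount (c : κ →₀ ℕ) (g : Equiv.Perm α) : ℕ :=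
  (Finset.univ.filter fun F : α → κ => (∀ a, F (g a) = F a) ∧ content F = c).card

theorem natCard_fixedBy (c : κ →₀ ℕ) (g : Equiv.Perm α) :
    Nat.card (MulAction.fixedBy (Fill α c) g) = fixedCount c g := by
  rw [fixedCount, ← Nat.card_eq_finsetCard]
  refine Nat.card_congr
    { toFun := fun F => ⟨F.1.1, Finset.mem_filter.2
        ⟨Finset.mem_univ _, (Fill.smul_eq_self_iff g F.1).1 F.2, F.1.2⟩⟩
      invFun := fun F => ⟨⟨F.1, (Finset.mem_filter.1 F.2).2.2⟩,
        (Fill.smul_eq_self_iff g _).2 (Finset.mem_filter.1 F.2).2.1⟩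
      left_inv := fun _ => rfl
      right_inv := fun _ => rfl }

/-- Burnside's count for the transitive action on the labellings of a fixed content. -/
theorem sum_fixedCount {c : κ →₀ ℕ}
    (h : c ∈ Finset.finsuppAntidiag Finset.univ (Fintype.card α)) :
    ∑ g : Equiv.Perm α, fixedCount c g = (Fintype.card α).factorial := by
  classical
  have : Fintype (Fill α c) := Fintype.ofFinite _
  have hn := Fill.nonempty h
  have : MulAction.IsPretransitive (Equiv.Perm α) (Fill α c) := ⟨Fill.exists_smul_eq⟩
  have key := MulAction.sum_card_fixedBy_eq_card_orbits_mul_card_group (Equiv.Perm α) (Fill α c)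
  have h1 : Fintype.card (Quotient (MulAction.orbitRel (Equiv.Perm α) (Fill α c))) = 1 := by
    rw [Fintype.card_eq_one_iff_nonempty_unique]
    exact (MulAction.pretransitive_iff_unique_quotient_of_nonempty _ _).1 this
  rw [h1, one_mul, Fintype.card_perm] at key
  rw [← key]
  exact Finset.sum_congr rfl fun g _ => by rw [← natCard_fixedBy, Nat.card_eq_fintype_card]

/-- Counting pairs of a permutation and a labelling fixed by it, weighted by content: every
content of the right size contributes `|α|!`. -/
theorem sum_perm_sum_fixed {R : Type} [CommSemiring R] (w : (κ →₀ ℕ) → R) :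
    ∑ g : Equiv.Perm α, ∑ F : α → κ with ∀ a, F (g a) = F a, w (content F) =
      (Fintype.card α).factorial *
        ∑ c ∈ Finset.finsuppAntidiag (Finset.univ : Finset κ) (Fintype.card α), w c := by
  have h1 : ∀ g : Equiv.Perm α, ∑ F : α → κ with ∀ a, F (g a) = F a, w (content F) =
      ∑ c ∈ Finset.finsuppAntidiag (Finset.univ : Finset κ) (Fintype.card α),
        (fixedCount c g : R) * w c := by
    intro g
    rw [← Finset.sum_fiberwise_of_maps_to (fun F _ => content_mem_finsuppAntidiag (α := α) F)]
    refine Finset.sum_congr rfl fun c _ => ?_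
    rw [Finset.sum_congr rfl (g := fun _ => w c)
      (fun F hF => by rw [(Finset.mem_filter.1 hF).2]), Finset.sum_const, nsmul_eq_mul,
      Finset.filter_filter]
    rfl
  rw [Finset.sum_congr rfl fun g _ => h1 g, Finset.sum_comm, Finset.mul_sum]
  refine Finset.sum_congr rfl fun c hc => ?_
  rw [← Finset.sum_mul, ← Nat.cast_sum, sum_fixedCount hc]

/-- The power sum symmetric polynomial of the cycle type of `g`, written as the sum of the
monomials of all labellings of the letters that are constant on the cycles of `g`. -/
def permPoly (κ : Type) [Fintype κ] [DecidableEq κ] (g : Equiv.Perm α) : MvPolynomial κ ℂ :=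
  ∑ F : α → κ with ∀ a, F (g a) = F a, MvPolynomial.monomial (content F) 1

variable (κ) in
/-- The complete homogeneous symmetric polynomial of degree `m`. -/
def completeHom (m : ℕ) : MvPolynomial κ ℂ :=
  ∑ c ∈ Finset.finsuppAntidiag (Finset.univ : Finset κ) m, MvPolynomial.monomial c 1

theorem coeff_permPoly (g : Equiv.Perm α) (c : κ →₀ ℕ) :
    (permPoly κ g).coeff c = fixedCount c g := by
  simp only [permPoly, MvPolynomial.coeff_sum, MvPolynomial.coeff_monomial]
  rw [Finset.sum_boole, Finset.filter_filter, fixedCount]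

theorem coeff_completeHom (m : ℕ) (c : κ →₀ ℕ) :
    (completeHom κ m).coeff c = if ∑ i, c i = m then 1 else 0 := by
  simp [completeHom, MvPolynomial.coeff_sum, MvPolynomial.coeff_monomial]

theorem permPoly_inv (g : Equiv.Perm α) : permPoly κ g⁻¹ = permPoly κ g := by
  refine Finset.sum_congr (Finset.filter_congr fun F _ => ?_) fun _ _ => rfl
  rw [← g.forall_congr_right]
  refine forall_congr' fun a => ?_
  rw [show g⁻¹ (g a) = a from g.symm_apply_apply a, eq_comm]

theorem sum_permPoly : ∑ g : Equiv.Perm α, permPoly κ g =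
    (Fintype.card α).factorial * completeHom κ (Fintype.card α) :=
  sum_perm_sum_fixed fun c => MvPolynomial.monomial c 1

/-- Pairs of labellings are labellings by pairs; the contents of these are the matrices with
prescribed marginals. -/
theorem sum_fixedCount_mul_permPoly {b : κ →₀ ℕ} (hb : ∑ j, b j = Fintype.card α) :
    ∑ g : Equiv.Perm α, (fixedCount b g : MvPolynomial κ ℂ) * permPoly κ g =
      (Fintype.card α).factorial * ∏ j, completeHom κ (b j) := by
  have hfst : ∀ F : α → κ × κ, (content F).mapDomain Prod.fst = content fun a => (F a).1 := by
    intro F; simp [content, Finsupp.mapDomain_finsetSum, Finsupp.mapDomain_single]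
  have hsnd : ∀ F : α → κ × κ, (content F).mapDomain Prod.snd = content fun a => (F a).2 := by
    intro F; simp [content, Finsupp.mapDomain_finsetSum, Finsupp.mapDomain_single]
  -- Weigh a labelling by pairs with the monomial of its first component, provided that its
  -- second component has content `b`.
  have key := sum_perm_sum_fixed (α := α) (κ := κ × κ) fun c =>
    if c.mapDomain Prod.snd = b then
      (MvPolynomial.monomial (c.mapDomain Prod.fst) 1 : MvPolynomial κ ℂ) else 0
  convert key using 1
  · refine Finset.sum_congr rfl fun g _ => ?_
    simp only [hfst, hsnd]
    rw [permPoly, fixedCount, Finset.card_eq_sum_ones, Nat.cast_sum, Finset.sum_mul_sum,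
      ← Finset.sum_product', ← Finset.sum_filter, Finset.filter_filter]
    refine Finset.sum_nbij' (fun P a => (P.2 a, P.1 a)) (fun F => (fun a => (F a).2, fun a => (F a).1))
      ?_ ?_ ?_ ?_ ?_
    · rintro ⟨P, Q⟩ h
      simp only [Finset.mem_product, Finset.mem_filter, Finset.mem_univ, true_and] at h ⊢
      exact ⟨fun a => Prod.ext (h.2 a) (h.1.1 a), h.1.2⟩
    · intro F h
      simp only [Finset.mem_product, Finset.mem_filter, Finset.mem_univ, true_and] at h ⊢
      exact ⟨⟨fun a => congrArg Prod.snd (h.1 a), h.2⟩, fun a => congrArg Prod.fst (h.1 a)⟩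
    · intros; rfl
    · intros; rfl
    · intros; simp
  · congr 1
    simp only [completeHom]
    rw [Finset.prod_univ_sum, ← Finset.sum_filter]
    have hs : ∀ (c : κ × κ →₀ ℕ) (j : κ), c.mapDomain Prod.snd j = ∑ i, c (i, j) := by
      intro c j
      rw [Finsupp.mapDomain, Finsupp.sum_fintype _ _ (by simp), Finsupp.finsetSum_apply,
        Fintype.sum_prod_type]
      simp [Finsupp.single_apply]
    have hf : ∀ c : κ × κ →₀ ℕ, c.mapDomain Prod.fst =
        ∑ j, Finsupp.equivFunOnFinite.symm fun i => c (i, j) := by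
      intro c
      ext i
      rw [Finsupp.mapDomain, Finsupp.sum_fintype _ _ (by simp), Finsupp.finsetSum_apply,
        Fintype.sum_prod_type_right, Finsupp.finsetSum_apply]
      simp [Finsupp.single_apply]
    refine Finset.sum_nbij' (fun C => Finsupp.equivFunOnFinite.symm fun p => C p.2 p.1)
      (fun c j => Finsupp.equivFunOnFinite.symm fun i => c (i, j)) ?_ ?_ ?_ ?_ ?_
    · intro C h
      simp only [Fintype.mem_piFinset, Finset.mem_finsuppAntidiag, Finset.subset_univ, and_true,
        Finset.mem_filter] at h ⊢
      refine ⟨?_, Finsupp.ext fun j => ?_⟩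
      · rw [← hb, Fintype.sum_prod_type_right]
        exact Finset.sum_congr rfl fun j _ => by simpa using h j
      · rw [hs]; simpa using h j
    · intro c h
      simp only [Fintype.mem_piFinset, Finset.mem_finsuppAntidiag, Finset.subset_univ, and_true,
        Finset.mem_filter] at h ⊢
      intro j
      rw [← h.2, hs]; simp
    · intro C _; ext; simp
    · intro C _; ext; simp
    · intro C _
      rw [hf, MvPolynomial.monomial_sum_one]
      congr 1
      ext; simp

/-- The power sum of a product permutation is the product of the power sums. -/
theorem permPoly_sumCongr {β γ : Type} [Fintype β] [DecidableEq β] [Fintype γ] [DecidableEq γ]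
    (e : β ⊕ γ ≃ α) (g : Equiv.Perm β) (h : Equiv.Perm γ) :
    permPoly κ (e.permCongr (Equiv.Perm.sumCongr g h)) = permPoly κ g * permPoly κ h := by
  rw [permPoly, permPoly, permPoly, Finset.sum_mul_sum, ← Finset.sum_product']
  refine Finset.sum_nbij' (fun F => (fun b => F (e (.inl b)), fun c => F (e (.inr c))))
    (fun P a => Sum.elim P.1 P.2 (e.symm a)) ?_ ?_ ?_ ?_ ?_
  · intro F hF
    simp only [Finset.mem_product, Finset.mem_filter, Finset.mem_univ, true_and] at hF ⊢
    exact ⟨fun b => by simpa using hF (e (.inl b)), fun b => by simpa using hF (e (.inr b))⟩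
  · intro P hP
    simp only [Finset.mem_product, Finset.mem_filter, Finset.mem_univ, true_and] at hP ⊢
    intro a
    obtain ⟨x, rfl⟩ := e.surjective a
    rcases x with b | c
    · simpa using hP.1 b
    · simpa using hP.2 c
  · intro F _
    funext a
    obtain ⟨x, rfl⟩ := e.surjective a
    rcases x with b | c <;> simp
  · intro P _; simp
  · intro F _
    rw [MvPolynomial.monomial_mul, one_mul]
    congr 2
    rw [content, ← e.sum_comp, Fintype.sum_sum_type]
    rfl

end Content

/-! ### Alternants, the Jacobi–Trudi identity, and Frobenius' class functions -/

section Alternant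

variable {N : ℕ}

/-- The staircase exponents `(N - 1, …, 1, 0)`. -/
def stair (i : Fin N) : ℕ := (Fin.rev i : ℕ)

/-- The exponent vector of a monomial in finitely many variables. -/
abbrev expo (e : Fin N → ℕ) : Fin N →₀ ℕ := Finsupp.equivFunOnFinite.symm e

/-- The alternant `det (x_k ^ e_i)`. -/
def alternant (e : Fin N → ℕ) : MvPolynomial (Fin N) ℂ :=
  (Matrix.of fun i k => (MvPolynomial.X k : MvPolynomial (Fin N) ℂ) ^ e i).det

theorem alternant_eq_sum (e : Fin N → ℕ) : alternant e =
    ∑ σ : Equiv.Perm (Fin N), MvPolynomial.monomial (expo fun i => e (σ i))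
      ((Equiv.Perm.sign σ : ℤ) : ℂ) := by
  rw [alternant, Matrix.det_apply']
  refine Finset.sum_congr rfl fun σ _ => ?_
  rw [MvPolynomial.monomial_eq, Finsupp.prod_fintype _ _ (by simp)]
  simp

theorem coeff_alternant_mul (e : Fin N → ℕ) (P : MvPolynomial (Fin N) ℂ) (b : Fin N →₀ ℕ) :
    (alternant e * P).coeff b = ∑ σ : Equiv.Perm (Fin N), ((Equiv.Perm.sign σ : ℤ) : ℂ) *
      if expo (fun i => e (σ i)) ≤ b then P.coeff (b - expo fun i => e (σ i)) else 0 := by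
  rw [alternant_eq_sum, Finset.sum_mul, MvPolynomial.coeff_sum]
  refine Finset.sum_congr rfl fun σ _ => ?_
  rw [MvPolynomial.coeff_monomial_mul', mul_ite, mul_zero]

theorem coeff_alternant_self {e : Fin N → ℕ} (he : Function.Injective e) :
    (alternant e).coeff (expo e) = 1 := by
  rw [alternant_eq_sum, MvPolynomial.coeff_sum, Finset.sum_eq_single 1]
  · simp
  · intro σ _ hσ
    rw [MvPolynomial.coeff_monomial, if_neg]
    intro h
    refine hσ (Equiv.ext fun i => he ?_)
    simpa using DFunLike.congr_fun h i
  · simp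

/-- The generating series `∏ 1 / (1 - x_k T)` of the complete homogeneous polynomials. -/
def completeSeries (N : ℕ) : PowerSeries (MvPolynomial (Fin N) ℂ) :=
  ∏ k, PowerSeries.mk fun n => (MvPolynomial.X k : MvPolynomial (Fin N) ℂ) ^ n

theorem coeff_completeSeries (m : ℕ) :
    PowerSeries.coeff m (completeSeries N) = completeHom (Fin N) m := by
  rw [completeSeries, PowerSeries.coeff_prod, completeHom]
  refine Finset.sum_congr rfl fun c _ => ?_
  rw [MvPolynomial.monomial_eq, Finsupp.prod_fintype _ _ (by simp)]
  simp

/-- The polynomial `∏_{i ≠ k} (1 - x_i T)`. -/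
def elemPolyAvoiding (k : Fin N) : Polynomial (MvPolynomial (Fin N) ℂ) :=
  ∏ i ∈ Finset.univ.erase k, (1 - Polynomial.C (MvPolynomial.X i) * Polynomial.X)

theorem natDegree_elemPolyAvoiding_lt (k : Fin N) : (elemPolyAvoiding k).natDegree < N := by
  have h : (elemPolyAvoiding k).natDegree ≤ ∑ i ∈ Finset.univ.erase k, 1 := by
    refine (Polynomial.natDegree_prod_le _ _).trans (Finset.sum_le_sum fun i _ => ?_)
    compute_degree
  have hN := k.pos
  rw [Finset.sum_const, Finset.card_erase_of_mem (Finset.mem_univ k), Finset.card_univ,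
    Fintype.card_fin, smul_eq_mul, mul_one] at h
  omega

/-- All factors cancel but one: the product is `1 / (1 - x_k T)`. -/
theorem elemPolyAvoiding_mul_completeSeries (k : Fin N) :
    (elemPolyAvoiding k : PowerSeries (MvPolynomial (Fin N) ℂ)) * completeSeries N =
      PowerSeries.mk fun n => MvPolynomial.X k ^ n := by
  have h1 : ∀ i : Fin N, ((1 - Polynomial.C (MvPolynomial.X i) * Polynomial.X :
      Polynomial (MvPolynomial (Fin N) ℂ)) : PowerSeries (MvPolynomial (Fin N) ℂ)) *
        PowerSeries.mk (fun n => MvPolynomial.X i ^ n) = 1 := by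
    intro i
    ext1 n
    rw [Polynomial.coe_sub, Polynomial.coe_mul, Polynomial.coe_one, Polynomial.coe_C,
      Polynomial.coe_X, sub_mul, one_mul, mul_assoc, map_sub, PowerSeries.coeff_C_mul]
    cases n with
    | zero => simp
    | succ n => simp [PowerSeries.coeff_succ_X_mul, pow_succ', PowerSeries.coeff_one]
  have h2 : (elemPolyAvoiding k : PowerSeries (MvPolynomial (Fin N) ℂ)) =
      ∏ i ∈ Finset.univ.erase k, ((1 - Polynomial.C (MvPolynomial.X i) * Polynomial.X :
        Polynomial (MvPolynomial (Fin N) ℂ)) : PowerSeries (MvPolynomial (Fin N) ℂ)) := by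
    rw [elemPolyAvoiding, ← Polynomial.coeToPowerSeries.ringHom_apply, map_prod]
    rfl
  rw [h2, completeSeries, ← Finset.mul_prod_erase _ _ (Finset.mem_univ k), mul_left_comm,
    ← Finset.prod_mul_distrib, Finset.prod_congr rfl fun i _ => h1 i, Finset.prod_const_one,
    mul_one]

/-- The matrix of complete homogeneous polynomials `h_{e_i - δ_j}`, where `δ` is the staircase and
`h` vanishes in negative degrees. -/
def completeMatrix (e : Fin N → ℕ) : Matrix (Fin N) (Fin N) (MvPolynomial (Fin N) ℂ) :=
  Matrix.of fun i j => if stair j ≤ e i then completeHom (Fin N) (e i - stair j) else 0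

/-- The coefficients of the product of a polynomial of degree less than `N` and a power series,
with the polynomial's coefficients listed along the staircase. -/
theorem coeff_polynomial_mul {R : Type} [CommRing R] {P : Polynomial R} (hP : P.natDegree < N)
    (H : PowerSeries R) (m : ℕ) : PowerSeries.coeff m ((P : PowerSeries R) * H) =
      ∑ j : Fin N, if stair j ≤ m then P.coeff (stair j) * PowerSeries.coeff (m - stair j) H
        else 0 := by
  have h : ∀ j : Fin N, (if stair j ≤ m then
      P.coeff (stair j) * PowerSeries.coeff (m - stair j) H else 0) =
        PowerSeries.coeff m (PowerSeries.C (P.coeff (stair j)) *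
          (PowerSeries.X ^ stair j * H)) := by
    intro j
    rw [PowerSeries.coeff_C_mul, PowerSeries.coeff_X_pow_mul', mul_ite, mul_zero]
  rw [Finset.sum_congr rfl fun j _ => h j]
  have hr : ∑ j : Fin N, PowerSeries.coeff m (PowerSeries.C (P.coeff (stair j)) *
        (PowerSeries.X ^ stair j * H)) = ∑ j : Fin N, PowerSeries.coeff m
          (PowerSeries.C (P.coeff j) * (PowerSeries.X ^ (j : ℕ) * H)) :=
    Equiv.sum_comp Fin.revPerm fun j : Fin N => PowerSeries.coeff m
      (PowerSeries.C (P.coeff j) * (PowerSeries.X ^ (j : ℕ) * H))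
  rw [hr, Fin.sum_univ_eq_sum_range (fun j => PowerSeries.coeff m
      (PowerSeries.C (P.coeff j) * (PowerSeries.X ^ j * H))), ← map_sum]
  congr 1
  conv_lhs => rw [P.as_sum_range_C_mul_X_pow' hP]
  rw [← Polynomial.coeToPowerSeries.ringHom_apply, map_sum, Finset.sum_mul]
  refine Finset.sum_congr rfl fun j _ => ?_
  rw [Polynomial.coeToPowerSeries.ringHom_apply, Polynomial.coe_mul, Polynomial.coe_C,
    Polynomial.coe_pow, Polynomial.coe_X, mul_assoc]

/-- Reading `elemPolyAvoiding_mul_completeSeries` in degrees `e_i` factors the matrix of the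
alternant. -/
theorem completeMatrix_mul (e : Fin N → ℕ) :
    completeMatrix e * Matrix.of (fun j k => (elemPolyAvoiding k).coeff (stair j)) =
      Matrix.of fun i k => MvPolynomial.X k ^ e i := by
  ext1 i k
  have h := congrArg (PowerSeries.coeff (e i)) (elemPolyAvoiding_mul_completeSeries k)
  rw [PowerSeries.coeff_mk, coeff_polynomial_mul (natDegree_elemPolyAvoiding_lt k)] at h
  rw [Matrix.mul_apply, Matrix.of_apply, ← h]
  refine Finset.sum_congr rfl fun j _ => ?_
  rw [completeMatrix, Matrix.of_apply, Matrix.of_apply, coeff_completeSeries, ite_mul, zero_mul,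
    mul_comm]

theorem det_completeMatrix_stair : (completeMatrix (stair (N := N))).det = 1 := by
  rw [Matrix.det_of_isUpperTriangular]
  · simp [completeMatrix, completeHom]
  · intro i j hij
    rw [completeMatrix, Matrix.of_apply, if_neg]
    simp only [stair, Fin.val_rev, id] at hij ⊢
    omega

/-- The Jacobi–Trudi identity. -/
theorem alternant_eq_det_mul (e : Fin N → ℕ) :
    alternant e = (completeMatrix e).det * alternant stair := by
  have h : ∀ e : Fin N → ℕ, alternant e = (completeMatrix e).det *
      (Matrix.of fun j k => (elemPolyAvoiding k).coeff (stair j)).det := fun e => by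
    rw [← Matrix.det_mul, completeMatrix_mul, alternant]
  rw [h stair, det_completeMatrix_stair, one_mul, ← h e]

variable {α : Type} [Fintype α] [DecidableEq α]

/-- Frobenius' formula: the coefficient of `x ^ e` in the product of the Vandermonde alternant and
the power sum of the cycle type of `g`. -/
def frobeniusChar (e : Fin N → ℕ) (g : Equiv.Perm α) : ℂ :=
  (alternant stair * permPoly (Fin N) g).coeff (expo e)

theorem frobeniusChar_eq_sum (e : Fin N → ℕ) (g : Equiv.Perm α) :
    frobeniusChar e g = ∑ σ : Equiv.Perm (Fin N), ((Equiv.Perm.sign σ : ℤ) : ℂ) *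
      if ∀ i, stair (σ i) ≤ e i then (fixedCount (expo fun i => e i - stair (σ i)) g : ℂ)
        else 0 := by
  rw [frobeniusChar, coeff_alternant_mul]
  refine Finset.sum_congr rfl fun σ _ => ?_
  have h : expo e - expo (fun i => stair (σ i)) = expo fun i => e i - stair (σ i) := by
    ext; simp
  rw [coeff_permPoly, h]
  congr 1
  exact if_congr Iff.rfl rfl rfl

/-- The Frobenius characteristic of `frobeniusChar (λ + δ)` is the Schur polynomial of `λ`, in the
form of a quotient of alternants. -/
theorem alternant_stair_mul_sum_frobeniusChar {e : Fin N → ℕ}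
    (he : ∑ i, e i = Fintype.card α + ∑ i : Fin N, stair i) :
    alternant stair * ∑ g : Equiv.Perm α,
      MvPolynomial.C (frobeniusChar e g) * permPoly (Fin N) g =
        ((Fintype.card α).factorial : MvPolynomial (Fin N) ℂ) * alternant e := by
  have h : ∑ g : Equiv.Perm α, MvPolynomial.C (frobeniusChar e g) * permPoly (Fin N) g =
      ((Fintype.card α).factorial : MvPolynomial (Fin N) ℂ) * (completeMatrix e).det := by
    rw [← Matrix.det_transpose, Matrix.det_apply', Finset.mul_sum]
    simp only [frobeniusChar_eq_sum, map_sum, Finset.sum_mul]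
    rw [Finset.sum_comm]
    refine Finset.sum_congr rfl fun σ _ => ?_
    by_cases hσ : ∀ i, stair (σ i) ≤ e i
    · have hsum : ∑ i, (expo fun i => e i - stair (σ i)) i = Fintype.card α := by
        have h1 : ∑ i, (e i - stair (σ i)) + ∑ i, stair (σ i) = ∑ i, e i := by
          rw [← Finset.sum_add_distrib]
          exact Finset.sum_congr rfl fun i _ => Nat.sub_add_cancel (hσ i)
        rw [Equiv.sum_comp σ (fun i => stair i), he] at h1
        simpa using h1
      have hprod : ∏ i, (completeMatrix e).transpose (σ i) i =
          ∏ i, completeHom (Fin N) ((expo fun i => e i - stair (σ i)) i) := by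
        refine Finset.prod_congr rfl fun i _ => ?_
        rw [Matrix.transpose_apply, completeMatrix, Matrix.of_apply, if_pos (hσ i)]
        rfl
      rw [hprod, mul_left_comm, ← sum_fixedCount_mul_permPoly hsum, Finset.mul_sum]
      refine Finset.sum_congr rfl fun g _ => ?_
      rw [if_pos hσ]
      simp [mul_assoc]
    · rw [Finset.sum_eq_zero fun g _ => by rw [if_neg hσ]; simp]
      obtain ⟨i, hi⟩ := not_forall.1 hσ
      rw [Finset.prod_eq_zero (Finset.mem_univ i)
        (by rw [Matrix.transpose_apply, completeMatrix, Matrix.of_apply, if_neg hi])]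
      simp
  rw [h, alternant_eq_det_mul e]
  ring

/-- The class function given by Frobenius' formula has norm one. -/
theorem sum_frobeniusChar_mul_self {e : Fin N → ℕ} (hinj : Function.Injective e)
    (he : ∑ i, e i = Fintype.card α + ∑ i : Fin N, stair i) :
    ∑ g : Equiv.Perm α, frobeniusChar e g * frobeniusChar e g = (Fintype.card α).factorial := by
  have h := congrArg (MvPolynomial.coeff (expo e)) (alternant_stair_mul_sum_frobeniusChar he)
  rw [← map_natCast (MvPolynomial.C (R := ℂ) (σ := Fin N)), MvPolynomial.coeff_C_mul, coeff_alternant_self hinj, mul_one,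
    Finset.mul_sum, MvPolynomial.coeff_sum] at h
  rw [← h]
  refine Finset.sum_congr rfl fun g _ => ?_
  rw [mul_left_comm, MvPolynomial.coeff_C_mul]
  rfl

theorem frobeniusChar_inv (e : Fin N → ℕ) (g : Equiv.Perm α) :
    frobeniusChar e g⁻¹ = frobeniusChar e g := by
  rw [frobeniusChar, frobeniusChar, permPoly_inv]

theorem conj_frobeniusChar (e : Fin N → ℕ) (g : Equiv.Perm α) :
    (starRingEnd ℂ) (frobeniusChar e g) = frobeniusChar e g := by
  simp only [frobeniusChar_eq_sum, map_sum, map_mul, apply_ite (starRingEnd ℂ), map_natCast,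
    map_intCast, map_zero]

end Alternant

/-! ### The alternant form of Pieri's rule, and horizontal strips -/

section Pieri

variable {N : ℕ}

/-- The comparison matrix of two strictly decreasing sequences is unitriangular if they
interlace. Otherwise it has a block of zeros which is too large, or two equal rows. -/
theorem det_comparison {a b : Fin N → ℕ} (ha : StrictAnti a) (hb : StrictAnti b) :
    (Matrix.of fun j i => if b j ≤ a i then (1 : ℂ) else 0).det =
      if (∀ i, b i ≤ a i) ∧ ∀ i j, i < j → a j < b i then 1 else 0 := by
  by_cases h1 : ∀ i, b i ≤ a i
  swap
  · rw [if_neg fun h => h1 h.1, Matrix.det_apply']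
    obtain ⟨i, hi⟩ := not_forall.1 h1
    refine Finset.sum_eq_zero fun σ _ => ?_
    have hk : ∃ k, ¬ b (σ k) ≤ a k := by
      by_contra! hσ
      -- `σ` would map the indices from `i` on injectively to the indices after `i`.
      have hcard : (Finset.Ici i).card ≤ (Finset.Ioi i).card := by
        refine Finset.card_le_card_of_injOn σ (fun k hk => ?_) σ.injective.injOn
        have hik : i ≤ k := by simpa using hk
        have h2 := hσ k
        have h3 := ha.antitone hik
        have h4 : i < σ k := hb.lt_iff_gt.1 (by omega)
        simpa using h4
      rw [Fin.card_Ici, Fin.card_Ioi] at hcard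
      have := i.2
      omega
    obtain ⟨k, hk⟩ := hk
    rw [Finset.prod_eq_zero (Finset.mem_univ k) (by rw [Matrix.of_apply, if_neg hk]), mul_zero]
  by_cases h2 : ∀ i j, i < j → a j < b i
  · rw [if_pos ⟨h1, h2⟩, Matrix.det_of_isLowerTriangular]
    · exact Finset.prod_eq_one fun i _ => by rw [Matrix.of_apply, if_pos (h1 i)]
    · intro j i hij
      rw [Matrix.of_apply, if_neg]
      have := h2 j i (by simpa using hij)
      omega
  · rw [if_neg fun h => h2 h.2]
    push Not at h2
    obtain ⟨i, hi, hmax⟩ := Finset.exists_max_image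
      (Finset.univ.filter fun i : Fin N => ∃ j, i < j ∧ b i ≤ a j) id
      (by obtain ⟨i, j, hij⟩ := h2; exact ⟨i, by simpa using ⟨j, hij⟩⟩)
    obtain ⟨j, hij, hbj⟩ : ∃ j, i < j ∧ b i ≤ a j := by simpa using hi
    have hlt : (i : ℕ) + 1 < N := by have := j.2; have : (i : ℕ) < j := hij; omega
    let i' : Fin N := ⟨i + 1, hlt⟩
    have hii' : i < i' := Fin.lt_def.2 (Nat.lt_succ_self _)
    have hi'j : i' ≤ j := Fin.le_def.2 hij
    have hbb := hb hii'
    -- By maximality of `i`, both rows are one exactly in the columns up to `i + 1`.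
    refine Matrix.det_zero_of_row_eq hii'.ne (funext fun k => ?_)
    rw [Matrix.of_apply, Matrix.of_apply]
    rcases le_or_gt k i' with hk | hk
    · have h3 := ha.antitone hi'j
      have h4 := ha.antitone hk
      rw [if_pos (by omega), if_pos (by omega)]
    · have h3 : ¬ b i' ≤ a k := fun h => absurd (hmax i' (by simpa using ⟨k, hk, h⟩))
        (by simpa using hii')
      rw [if_neg (by omega), if_neg h3]

/-- The alternating sum expanding the coefficient is the determinant of the comparison matrix. -/
theorem coeff_alternant_mul_completeHom {a b : Fin N → ℕ} (ha : StrictAnti a) (hb : StrictAnti b)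
    {m : ℕ} (h : ∑ i, a i = ∑ i, b i + m) :
    (alternant b * completeHom (Fin N) m).coeff (expo a) =
      if (∀ i, b i ≤ a i) ∧ ∀ i j, i < j → a j < b i then 1 else 0 := by
  rw [← det_comparison ha hb, coeff_alternant_mul, Matrix.det_apply']
  refine Finset.sum_congr rfl fun σ _ => ?_
  congr 1
  by_cases hσ : ∀ i, b (σ i) ≤ a i
  · rw [if_pos (show expo (fun i => b (σ i)) ≤ expo a from hσ), coeff_completeHom, if_pos,
      Finset.prod_eq_one fun i _ => by rw [Matrix.of_apply, if_pos (hσ i)]]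
    have h1 : ∑ i, (a i - b (σ i)) + ∑ i, b (σ i) = ∑ i, a i := by
      rw [← Finset.sum_add_distrib]
      exact Finset.sum_congr rfl fun i _ => Nat.sub_add_cancel (hσ i)
    rw [Equiv.sum_comp σ b] at h1
    have h2 : ∑ i, (expo a - expo fun i => b (σ i)) i = ∑ i, (a i - b (σ i)) := by simp
    omega
  · rw [if_neg (show ¬ expo (fun i => b (σ i)) ≤ expo a from hσ)]
    obtain ⟨k, hk⟩ := not_forall.1 hσ
    rw [Finset.prod_eq_zero (Finset.mem_univ k) (by rw [Matrix.of_apply, if_neg hk])]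

/-- The skew diagram `ν / λ` is a horizontal strip: it has at most one cell in each column. -/
def IsHorizontalStrip (lam nu : YoungDiagram) : Prop :=
  ∀ i, lam.rowLen i ≤ nu.rowLen i ∧ nu.rowLen (i + 1) ≤ lam.rowLen i

/-- The strictly decreasing exponents `λ + δ`. -/
def shifted (N : ℕ) (lam : YoungDiagram) (i : Fin N) : ℕ := lam.rowLen i + stair i

theorem shifted_strictAnti (lam : YoungDiagram) : StrictAnti (shifted N lam) := by
  intro i j hij
  have h1 := lam.rowLen_anti i j hij.le
  have h2 : (i : ℕ) < j := hij
  have := j.2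
  simp only [shifted, stair, Fin.val_rev]
  omega

theorem rowLen_eq_zero {lam : YoungDiagram} {i : ℕ} (h : lam.colLen 0 ≤ i) : lam.rowLen i = 0 := by
  by_contra hne
  have : (i, 0) ∈ lam := YoungDiagram.mem_iff_lt_rowLen.2 (Nat.pos_of_ne_zero hne)
  have := YoungDiagram.mem_iff_lt_colLen.1 this
  omega

theorem sum_rowLen {lam : YoungDiagram} (h : lam.colLen 0 ≤ N) :
    ∑ i : Fin N, lam.rowLen i = lam.card := by
  rw [Fin.sum_univ_eq_sum_range, YoungDiagram.card,
    Finset.card_eq_sum_card_fiberwise (f := Prod.fst) (t := Finset.range N)]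
  · exact Finset.sum_congr rfl fun i _ => lam.rowLen_eq_card
  · intro c hc
    have h1 : (c.1, 0) ∈ lam := lam.up_left_mem le_rfl (Nat.zero_le c.2) hc
    have := YoungDiagram.mem_iff_lt_colLen.1 h1
    simp only [Finset.coe_range, Set.mem_Iio]
    omega

theorem sum_shifted {lam : YoungDiagram} (h : lam.colLen 0 ≤ N) :
    ∑ i, shifted N lam i = lam.card + ∑ i : Fin N, stair i := by
  rw [← sum_rowLen h, ← Finset.sum_add_distrib]
  rfl

theorem isHorizontalStrip_iff_shifted {lam nu : YoungDiagram} (hnu : nu.colLen 0 ≤ N)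
    (hlam : lam.colLen 0 ≤ N) : IsHorizontalStrip lam nu ↔
      (∀ i, shifted N lam i ≤ shifted N nu i) ∧
        ∀ i j, i < j → shifted N nu j < shifted N lam i := by
  constructor
  · refine fun h => ⟨fun i => Nat.add_le_add_right (h i).1 _, fun i j hij => ?_⟩
    have h1 := (h i).2
    have h2 : (i : ℕ) < j := hij
    have h3 := nu.rowLen_anti (i + 1) j h2
    have := j.2
    simp only [shifted, stair, Fin.val_rev]
    omega
  · refine fun h i => ⟨?_, ?_⟩
    · by_cases hi : i < N
      · exact Nat.le_of_add_le_add_right (h.1 ⟨i, hi⟩)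
      · rw [rowLen_eq_zero (hlam.trans (not_lt.1 hi))]
        exact Nat.zero_le _
    · by_cases hi : i + 1 < N
      · have h1 := h.2 ⟨i, by omega⟩ ⟨i + 1, hi⟩ (Fin.lt_def.2 (Nat.lt_succ_self i))
        simp only [shifted, stair, Fin.val_rev] at h1
        omega
      · rw [rowLen_eq_zero (hnu.trans (not_lt.1 hi))]
        exact Nat.zero_le _

end Pieri

section Padded

theorem rowLen_ofRowLens_eq_getD (w : List ℕ) (hw : w.SortedGE) (i : ℕ) :
    (YoungDiagram.ofRowLens w hw).rowLen i = w.getD i 0 := by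
  refine eq_of_forall_lt_iff fun j => ?_
  rw [← YoungDiagram.mem_iff_lt_rowLen, YoungDiagram.mem_ofRowLens, List.getD_eq_getElem?_getD]
  by_cases h : i < w.length <;> simp [h]

theorem colLen_ofRowLens_le (w : List ℕ) (hw : w.SortedGE) :
    (YoungDiagram.ofRowLens w hw).colLen 0 ≤ w.length := by
  by_contra! h
  obtain ⟨h1, -⟩ := YoungDiagram.mem_ofRowLens.1 (YoungDiagram.mem_iff_lt_colLen.2 h)
  exact lt_irrefl _ h1

theorem oneRow_rowLen_zero (k : ℕ) : (oneRow k).rowLen 0 = k := by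
  simp [oneRow, rowLen_ofRowLens_eq_getD]

theorem card_oneRow (k : ℕ) : (oneRow k).card = k := by
  rw [← sum_rowLen (N := 1) (colLen_ofRowLens_le _ _)]
  simp [oneRow_rowLen_zero]

theorem padded_rowLen_zero (lam : YoungDiagram) (n : ℕ) (h : lam.card + lam.rowLen 0 ≤ n) :
    (padded lam n h).rowLen 0 = n - lam.card := by
  simp [padded, rowLen_ofRowLens_eq_getD]

theorem padded_rowLen_succ (lam : YoungDiagram) (n : ℕ) (h : lam.card + lam.rowLen 0 ≤ n) (i : ℕ) :
    (padded lam n h).rowLen (i + 1) = lam.rowLen i := by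
  rw [padded, rowLen_ofRowLens_eq_getD, List.getD_cons_succ, List.getD_eq_getElem?_getD]
  by_cases hi : i < lam.colLen 0
  · simp [YoungDiagram.rowLens, hi]
  · simp [YoungDiagram.rowLens, hi, rowLen_eq_zero (not_lt.1 hi)]

theorem card_padded (lam : YoungDiagram) (n : ℕ) (h : lam.card + lam.rowLen 0 ≤ n) :
    (padded lam n h).card = n := by
  rw [← sum_rowLen (lam := padded lam n h) (N := lam.colLen 0 + 1)
      ((colLen_ofRowLens_le _ _).trans (by simp)),
    Fin.sum_univ_succ]
  simp only [Fin.val_succ, Fin.val_zero, padded_rowLen_succ, padded_rowLen_zero, sum_rowLen le_rfl]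
  omega

/-- Flipping a horizontal strip `ξ / λ` gives the horizontal strip `λ[n] / ξ`. -/
theorem isHorizontalStrip_padded_iff (lam xi : YoungDiagram) (n : ℕ)
    (h : lam.card + lam.rowLen 0 ≤ n) :
    IsHorizontalStrip xi (padded lam n h) ↔
      IsHorizontalStrip lam xi ∧ lam.card + xi.rowLen 0 ≤ n := by
  constructor
  · intro hs
    refine ⟨fun i => ⟨?_, ?_⟩, ?_⟩
    · simpa [padded_rowLen_succ] using (hs i).2
    · simpa [padded_rowLen_succ] using (hs (i + 1)).1
    · have := (hs 0).1
      rw [padded_rowLen_zero] at this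
      omega
  · rintro ⟨hs, h0⟩ i
    refine ⟨?_, by simpa [padded_rowLen_succ] using (hs i).1⟩
    cases i with
    | zero => rw [padded_rowLen_zero]; omega
    | succ i => simpa [padded_rowLen_succ] using (hs i).2

end Padded

/-! ### Characters of representations of finite groups -/

section Characters

variable {G V W : Type} [Group G] [AddCommGroup V] [Module ℂ V] [AddCommGroup W] [Module ℂ W]

/-- The eigenvalues of an element of finite order are roots of unity, whose inverses are their
conjugates. -/
theorem character_inv [Finite G] [FiniteDimensional ℂ V] (ρ : Representation ℂ G V) (g : G) :
    ρ.character g⁻¹ = (starRingEnd ℂ) (ρ.character g) := by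
  have hk : orderOf g ≠ 0 := (orderOf_pos g).ne'
  have hpow : ρ g ^ orderOf g = 1 := by rw [← map_pow, pow_orderOf_eq_one, map_one]
  have hss : Module.End.IsSemisimple (ρ g) := by
    refine Module.End.isSemisimple_of_squarefree_aeval_eq_zero (f := ρ g)
      (p := Polynomial.X ^ orderOf g - 1) ?_ (by simp [hpow])
    exact (Polynomial.X_pow_sub_one_separable_iff.2 (Nat.cast_ne_zero.2 hk)).squarefree
  let E : ℂ → Submodule ℂ V := fun μ => Module.End.eigenspace (ρ g) μ
  have hE : DirectSum.IsInternal E :=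
    DirectSum.isInternal_submodule_of_iSupIndep_of_iSup_eq_top
      (Module.End.eigenspaces_iSupIndep (ρ g)) hss.iSup_eigenspace_eq_top
  have hfin : {μ | E μ ≠ ⊥}.Finite :=
    WellFoundedGT.finite_ne_bot_of_iSupIndep hE.submodule_iSupIndep
  have hmem : ∀ μ x, x ∈ E μ ↔ ρ g x = μ • x := fun μ x => Module.End.mem_eigenspace_iff
  have hroot : ∀ μ, E μ ≠ ⊥ → μ⁻¹ = (starRingEnd ℂ) μ := by
    intro μ hμ
    obtain ⟨x, hx, hx0⟩ := (Submodule.ne_bot_iff _).1 hμ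
    have h1 : ∀ n : ℕ, (ρ g ^ n) x = μ ^ n • x := by
      intro n
      induction n with
      | zero => simp
      | succ n ih => rw [pow_succ', Module.End.mul_apply, ih, map_smul, (hmem μ x).1 hx, smul_smul,
          pow_succ]
    have h2 := h1 (orderOf g)
    rw [hpow, Module.End.one_apply] at h2
    have h3 : μ ^ orderOf g = 1 := by
      by_contra hne
      exact (sub_ne_zero.2 hne)
        ((smul_eq_zero.1 (by rw [sub_smul, one_smul, ← h2, sub_self] :
          (μ ^ orderOf g - 1) • x = 0)).resolve_right hx0)
    exact Complex.inv_eq_conj (Complex.norm_eq_one_of_pow_eq_one h3 hk)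
  have hinv : ∀ μ x, x ∈ E μ → E μ ≠ ⊥ → ρ g⁻¹ x = μ⁻¹ • x := by
    intro μ x hx hμ
    have hμ0 : μ ≠ 0 := by
      rintro rfl
      refine hμ ((Submodule.eq_bot_iff _).2 fun y hy => ?_)
      have h1 := (hmem 0 y).1 hy
      rw [zero_smul] at h1
      rw [← Representation.inv_self_apply ρ g y, h1, map_zero]
    have h1 := congrArg (ρ g⁻¹) ((hmem μ x).1 hx)
    rw [Representation.inv_self_apply, map_smul] at h1
    rw [h1, smul_smul, inv_mul_cancel₀ hμ0, one_smul, ← h1]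
  have hmaps : ∀ μ, Set.MapsTo (ρ g) (E μ) (E μ) := by
    intro μ x hx
    rw [SetLike.mem_coe] at hx ⊢
    rw [(hmem μ x).1 hx]
    exact (E μ).smul_mem _ hx
  have hmaps' : ∀ μ, Set.MapsTo (ρ g⁻¹) (E μ) (E μ) := by
    intro μ x hx
    rw [SetLike.mem_coe] at hx ⊢
    by_cases hμ : E μ = ⊥
    · rw [hμ, Submodule.mem_bot] at hx
      rw [hx, map_zero]
      exact (E μ).zero_mem
    · rw [hinv μ x hx hμ]
      exact (E μ).smul_mem _ hx
  rw [Representation.character, Representation.character,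
    LinearMap.trace_eq_sum_trace_restrict' hE hfin hmaps,
    LinearMap.trace_eq_sum_trace_restrict' hE hfin hmaps', map_sum]
  refine Finset.sum_congr rfl fun μ hμ => ?_
  have hμ' : E μ ≠ ⊥ := by simpa using hμ
  have h1 : (ρ g).restrict (hmaps μ) = μ • LinearMap.id :=
    LinearMap.ext fun x => Subtype.ext ((hmem μ x).1 x.2)
  have h2 : (ρ g⁻¹).restrict (hmaps' μ) = μ⁻¹ • LinearMap.id :=
    LinearMap.ext fun x => Subtype.ext (hinv μ x x.2 hμ')
  rw [h1, h2, map_smul, map_smul, LinearMap.trace_id, smul_eq_mul, smul_eq_mul, map_mul,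
    hroot μ hμ', map_natCast]

theorem character_ofMulAction (X : Type) [Finite X] [MulAction G X] (g : G) :
    (Representation.ofMulAction ℂ G X).character g = Nat.card (MulAction.fixedBy X g) := by
  classical
  have : Fintype X := Fintype.ofFinite X
  let b : Module.Basis X ℂ ℂ[X] := ⟨MonoidAlgebra.coeffLinearEquiv ℂ⟩
  rw [Representation.character, LinearMap.trace_eq_matrix_trace ℂ b, Matrix.trace]
  have hdiag : ∀ x, Matrix.diag (LinearMap.toMatrix b b (Representation.ofMulAction ℂ G X g)) x =
      if g • x = x then 1 else 0 := by
    intro x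
    have hb : b x = MonoidAlgebra.single x 1 := rfl
    rw [Matrix.diag_apply, LinearMap.toMatrix_apply, hb, Representation.ofMulAction_single]
    exact Finsupp.single_apply
  rw [Finset.sum_congr rfl fun x _ => hdiag x, Finset.sum_boole, Nat.card_eq_fintype_card,
    Fintype.card_subtype]
  rfl

theorem finrank_intertwiningMap_eq [Fintype G] [FiniteDimensional ℂ V] [FiniteDimensional ℂ W]
    (ρ : Representation ℂ G V) (σ : Representation ℂ G W) :
    ∑ g, σ.character g * ρ.character g⁻¹ =
      Fintype.card G * Module.finrank ℂ (Representation.IntertwiningMap ρ σ) := by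
  have h0 : (Nat.card G : ℂ) ≠ 0 := Nat.cast_ne_zero.2 Nat.card_pos.ne'
  have : Invertible (Nat.card G : ℂ) := invertibleOfNonzero h0
  rw [← Representation.card_inv_mul_sum_char_mul_char_eq_finrank, ← Nat.card_eq_fintype_card,
    mul_inv_cancel_left₀ h0]

/-- Frobenius reciprocity. -/
theorem finrank_intertwiningMap_ind {H : Type} [Group H] (φ : G →* H) (ρ : Representation ℂ G V)
    (σ : Representation ℂ H W) :
    Module.finrank ℂ (Representation.IntertwiningMap (Representation.ind φ ρ) σ) =
      Module.finrank ℂ (Representation.IntertwiningMap ρ (σ.comp φ)) := by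
  have e1 : (Rep.of (Representation.ind φ ρ) ⟶ Rep.of σ) ≃ₗ[ℂ]
      Representation.IntertwiningMap (Representation.ind φ ρ) σ :=
    { Rep.homEquiv with
      map_add' := fun _ _ => rfl
      map_smul' := fun _ _ => rfl }
  have e2 : (Rep.of ρ ⟶ Rep.res φ (Rep.of σ)) ≃ₗ[ℂ]
      Representation.IntertwiningMap ρ (σ.comp φ) :=
    { Rep.homEquiv with
      map_add' := fun _ _ => rfl
      map_smul' := fun _ _ => rfl }
  exact (e1.symm.trans ((Rep.indResHomEquiv φ (Rep.of ρ) (Rep.of σ)).trans e2)).finrank_eq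

end Characters

/-! ### Homomorphisms out of Specht modules -/

section ColumnWeights

/-- Among the sets of `k` natural numbers, `{0, …, k - 1}` is the only one with the least sum. -/
theorem sum_range_card_lt_sum {S : Finset ℕ} (h : S ≠ Finset.range S.card) :
    ∑ i ∈ Finset.range S.card, i < ∑ i ∈ S, i := by
  set k := S.card
  have hcard : (Finset.range k \ S).card = (S \ Finset.range k).card :=
    Finset.card_sdiff_comm (by simp [k])
  have hne : (Finset.range k \ S).Nonempty := by
    rw [← Finset.card_pos, hcard, Finset.card_pos, Finset.sdiff_nonempty]
    exact fun hsub => h (Finset.eq_of_subset_of_card_le hsub (by simp [k]))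
  have h1 : ∑ i ∈ Finset.range k \ S, i < ∑ _i ∈ Finset.range k \ S, k :=
    Finset.sum_lt_sum_of_nonempty hne fun i hi =>
      Finset.mem_range.1 (Finset.mem_sdiff.1 hi).1
  have h2 : ∑ _i ∈ S \ Finset.range k, k ≤ ∑ i ∈ S \ Finset.range k, i :=
    Finset.sum_le_sum fun i hi => by simpa using (Finset.mem_sdiff.1 hi).2
  rw [Finset.sum_const, hcard, ← Finset.sum_const] at h1
  have h3 := Finset.sum_inter_add_sum_sdiff (Finset.range k) S fun i => i
  have h4 := Finset.sum_inter_add_sum_sdiff S (Finset.range k) fun i => i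
  rw [Finset.inter_comm] at h3
  omega

variable {α : Type} [Fintype α] {lam : YoungDiagram}

theorem Tableau.card_col (t : Tableau α lam) (j : ℕ) :
    (Finset.univ.filter fun a => (t a).1.2 = j).card = lam.colLen j := by
  rw [YoungDiagram.colLen_eq_card]
  refine Finset.card_bij (fun a _ => (t a).1) (fun a ha => ?_) (fun a _ b _ h => ?_)
    fun c hc => ?_
  · exact YoungDiagram.mem_col_iff.2 ⟨(t a).2, (Finset.mem_filter.1 ha).2⟩
  · exact t.injective (Subtype.ext h)
  · obtain ⟨hc1, hc2⟩ := YoungDiagram.mem_col_iff.1 hc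
    exact ⟨t.symm ⟨c, hc1⟩, by simpa using hc2, by simp⟩

theorem Tableau.image_row_col (t : Tableau α lam) (j : ℕ) :
    (Finset.univ.filter fun a => (t a).1.2 = j).image (fun a => (t a).1.1) =
      Finset.range (lam.colLen j) := by
  ext i
  simp only [Finset.mem_image, Finset.mem_filter, Finset.mem_univ, true_and, Finset.mem_range,
    ← YoungDiagram.mem_iff_lt_colLen]
  constructor
  · rintro ⟨a, rfl, rfl⟩
    exact (t a).2
  · exact fun h => ⟨t.symm ⟨(i, j), h⟩, by simp, by simp⟩

/-- Among the labellings that are injective on the columns of a tableau, the row labelling has the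
least sum; a labelling with the same sum uses the labels `0, …, k - 1` in a column of length `k`. -/
theorem Tableau.row_weight (t : Tableau α lam) {F : α → ℕ}
    (hF : ∀ a b, (t a).1.2 = (t b).1.2 → F a = F b → a = b) :
    ∑ a, (t a).1.1 ≤ ∑ a, F a ∧
      (∑ a, F a ≤ ∑ a, (t a).1.1 → ∀ a, F a < lam.colLen (t a).1.2) := by
  let col : ℕ → Finset α := fun j => Finset.univ.filter fun a => (t a).1.2 = j
  let J : Finset ℕ := Finset.univ.image fun a => (t a).1.2
  have hsplit : ∀ f : α → ℕ, ∑ a, f a = ∑ j ∈ J, ∑ a ∈ col j, f a := fun f =>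
    (Finset.sum_fiberwise_of_maps_to (fun a ha => Finset.mem_image_of_mem _ ha) _).symm
  have hcard : ∀ j, ((col j).image F).card = lam.colLen j := by
    intro j
    rw [Finset.card_image_of_injOn, t.card_col]
    intro a ha b hb hab
    refine hF a b ?_ hab
    rw [(Finset.mem_filter.1 ha).2, (Finset.mem_filter.1 hb).2]
  have hsF : ∀ j, ∑ a ∈ col j, F a = ∑ i ∈ (col j).image F, i := by
    intro j
    rw [Finset.sum_image]
    intro a ha b hb hab
    refine hF a b ?_ hab
    rw [(Finset.mem_filter.1 ha).2, (Finset.mem_filter.1 hb).2]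
  have hsR : ∀ j, ∑ a ∈ col j, (t a).1.1 = ∑ i ∈ Finset.range (lam.colLen j), i := by
    intro j
    rw [← t.image_row_col j, Finset.sum_image]
    intro a ha b hb hab
    refine t.injective (Subtype.ext (Prod.ext hab ?_))
    rw [(Finset.mem_filter.1 ha).2, (Finset.mem_filter.1 hb).2]
  have hcol : ∀ j, ∑ a ∈ col j, (t a).1.1 ≤ ∑ a ∈ col j, F a := by
    intro j
    rw [hsR, hsF, ← hcard j]
    by_cases h : (col j).image F = Finset.range ((col j).image F).card
    · exact le_of_eq (congrArg (fun S : Finset ℕ => ∑ i ∈ S, i) h).symm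
    · exact (sum_range_card_lt_sum h).le
  refine ⟨by rw [hsplit, hsplit]; exact Finset.sum_le_sum fun j _ => hcol j, fun hle a => ?_⟩
  have hJ : (t a).1.2 ∈ J := Finset.mem_image_of_mem _ (Finset.mem_univ a)
  have himg : (col (t a).1.2).image F = Finset.range (lam.colLen (t a).1.2) := by
    by_contra hne
    refine absurd hle (not_le.2 ?_)
    rw [hsplit, hsplit]
    refine Finset.sum_lt_sum (fun j _ => hcol j) ⟨_, hJ, ?_⟩
    rw [hsR, hsF]
    rw [← hcard] at hne ⊢
    exact sum_range_card_lt_sum hne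
  rw [← Finset.mem_range, ← himg]
  exact Finset.mem_image_of_mem _ (Finset.mem_filter.2 ⟨Finset.mem_univ a, rfl⟩)

/-- The sum of the row labels depends only on the shape. -/
theorem Tabloid.sum_eq (T T' : Tabloid α lam) : ∑ a, T.1 a = ∑ a, T'.1 a := by
  let J : Finset ℕ := Finset.univ.image T.1 ∪ Finset.univ.image T'.1
  have h : ∀ U : Tabloid α lam, (∀ a, U.1 a ∈ J) → ∑ a, U.1 a = ∑ i ∈ J, lam.rowLen i * i := by
    intro U hU
    rw [← Finset.sum_fiberwise_of_maps_to (fun a _ => hU a)]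
    refine Finset.sum_congr rfl fun i _ => ?_
    rw [Finset.sum_congr rfl (g := fun _ => i) (fun a ha => (Finset.mem_filter.1 ha).2),
      Finset.sum_const, smul_eq_mul, ← U.2 i, Nat.card_eq_fintype_card, Fintype.card_subtype]
  rw [h T fun a => Finset.mem_union_left _ (Finset.mem_image_of_mem _ (Finset.mem_univ a)),
    h T' fun a => Finset.mem_union_right _ (Finset.mem_image_of_mem _ (Finset.mem_univ a))]

/-- A tabloid which is injective on the columns of `t` comes from `{t}` by a column permutation. -/
theorem Tableau.exists_columnPerm (t : Tableau α lam) (T : Tabloid α lam)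
    (hT : ∀ a b, (t a).1.2 = (t b).1.2 → T.1 a = T.1 b → a = b) :
    ∃ σ, t.IsColumnPerm σ ∧ T = σ • t.tabloid := by
  have hlt := (t.row_weight hT).2 (Tabloid.sum_eq T t.tabloid).le
  -- `f` moves each letter within its column to the row that `T` assigns to it.
  let f : α → α := fun a => t.symm ⟨(T.1 a, (t a).1.2), YoungDiagram.mem_iff_lt_colLen.2 (hlt a)⟩
  have htf : ∀ a, (t (f a)).1 = (T.1 a, (t a).1.2) := fun a => by simp [f]
  have hinj : Function.Injective f := by
    intro a b hab
    have h1 := htf a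
    rw [hab, htf b] at h1
    exact hT a b (Prod.ext_iff.1 h1).2.symm (Prod.ext_iff.1 h1).1.symm
  let σ : Equiv.Perm α := Equiv.ofBijective f (Finite.injective_iff_bijective.1 hinj)
  refine ⟨σ⁻¹, fun a => ?_, Subtype.ext (funext fun a => ?_)⟩
  · have h1 := htf (σ⁻¹ a)
    rw [show f (σ⁻¹ a) = a from σ.apply_symm_apply a] at h1
    rw [h1]
  · change T.1 a = (t (σ⁻¹⁻¹ a)).1.1
    rw [inv_inv, show σ a = f a from rfl, htf]

end ColumnWeights

section Specht

variable {α : Type} {lam : YoungDiagram}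

theorem Tableau.IsColumnPerm.mul {t : Tableau α lam} {σ τ : Equiv.Perm α}
    (hσ : t.IsColumnPerm σ) (hτ : t.IsColumnPerm τ) : t.IsColumnPerm (σ * τ) :=
  fun a => (hσ (τ a)).trans (hτ a)

theorem Tableau.IsColumnPerm.inv {t : Tableau α lam} {σ : Equiv.Perm α}
    (hσ : t.IsColumnPerm σ) : t.IsColumnPerm σ⁻¹ := fun a => by
  rw [← hσ (σ⁻¹ a), show σ (σ⁻¹ a) = a from σ.apply_symm_apply a]

variable [DecidableEq α]

theorem apply_swap_eq {β : Type} {f : α → β} {a b : α} (h : f a = f b) (c : α) :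
    f (Equiv.swap a b c) = f c := by
  rw [Equiv.swap_apply_def]
  split_ifs with h1 h2
  · rw [h1, h]
  · rw [h2, h]
  · rfl

theorem isColumnPerm_swap {t : Tableau α lam} {a b : α} (h : (t a).1.2 = (t b).1.2) :
    t.IsColumnPerm (Equiv.swap a b) :=
  apply_swap_eq (f := fun c => (t c).1.2) h

variable [Fintype α]

/-- An element of a permutation module is alternating for `t` if the column permutations of `t`
act on it by their signs. -/
def Tableau.IsAlternating (t : Tableau α lam) {X : Type} [MulAction (Equiv.Perm α) X]
    (v : ℂ[X]) : Prop :=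
  ∀ σ, t.IsColumnPerm σ →
    Representation.ofMulAction ℂ (Equiv.Perm α) X σ v = ((Equiv.Perm.sign σ : ℤ) : ℂ) • v

theorem sign_mul_sign (σ : Equiv.Perm α) :
    ((Equiv.Perm.sign σ : ℤ) : ℂ) * ((Equiv.Perm.sign σ : ℤ) : ℂ) = 1 := by
  rw [← Int.cast_mul, ← Units.val_mul, Int.units_mul_self, Units.val_one, Int.cast_one]

theorem Tableau.IsAlternating.coeff_smul {t : Tableau α lam} {X : Type}
    [MulAction (Equiv.Perm α) X] {v : ℂ[X]} (hv : t.IsAlternating v) {σ : Equiv.Perm α}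
    (hσ : t.IsColumnPerm σ) (x : X) :
    v.coeff (σ • x) = ((Equiv.Perm.sign σ : ℤ) : ℂ) * v.coeff x := by
  have h := congrArg (fun w : ℂ[X] => w.coeff (σ • x)) (hv σ hσ)
  simp only [Representation.coeff_ofMulAction, inv_smul_smul, MonoidAlgebra.coeff_smul,
    Finsupp.smul_apply, smul_eq_mul] at h
  rw [h, ← mul_assoc, sign_mul_sign, one_mul]

/-- The coefficient at a point fixed by a transposition in the column stabiliser vanishes. -/
theorem Tableau.IsAlternating.coeff_eq_zero {t : Tableau α lam} {X : Type}
    [MulAction (Equiv.Perm α) X] {v : ℂ[X]} (hv : t.IsAlternating v) {a b : α} (hab : a ≠ b)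
    (hcol : (t a).1.2 = (t b).1.2) {x : X} (hx : Equiv.swap a b • x = x) : v.coeff x = 0 := by
  have h := hv.coeff_smul (isColumnPerm_swap hcol) x
  rw [hx, Equiv.Perm.sign_swap hab] at h
  simp only [Units.val_neg, Units.val_one, Int.cast_neg, Int.cast_one, neg_mul, one_mul] at h
  exact self_eq_neg.1 h

theorem Tableau.isAlternating_polytabloid (t : Tableau α lam) :
    t.IsAlternating t.polytabloid := by
  intro τ hτ
  simp only [Tableau.polytabloid, map_sum, Representation.ofMulAction_single, Finset.smul_sum]
  refine Finset.sum_equiv (Equiv.mulLeft τ) (fun σ => ?_) (fun σ _ => ?_)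
  · simp only [Finset.mem_filter, Finset.mem_univ, true_and, Equiv.coe_mulLeft]
    exact ⟨fun h => hτ.mul h, fun h => by simpa using hτ.inv.mul h⟩
  · rw [Equiv.coe_mulLeft, MonoidAlgebra.smul_single, Equiv.Perm.sign_mul, Units.val_mul,
      Int.cast_mul, smul_eq_mul, ← mul_assoc, sign_mul_sign, one_mul, mul_smul]

theorem Tableau.polytabloid_coeff_self (t : Tableau α lam) : t.polytabloid.coeff t.tabloid = 1 := by
  classical
  have h1 : t.polytabloid.coeff t.tabloid = ∑ σ : Equiv.Perm α with t.IsColumnPerm σ,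
      if σ • t.tabloid = t.tabloid then ((Equiv.Perm.sign σ : ℤ) : ℂ) else 0 := by
    simp only [Tableau.polytabloid, MonoidAlgebra.coeff_sum, Finsupp.finsetSum_apply]
    exact Finset.sum_congr rfl fun σ _ => Finsupp.single_apply
  rw [h1, Finset.sum_eq_single 1]
  · simp
  · intro σ hσ hne
    rw [if_neg]
    intro h
    refine hne (inv_eq_one.1 (Equiv.ext fun a => t.injective (Subtype.ext (Prod.ext ?_ ?_))))
    · exact congrFun (congrArg Subtype.val h) a
    · exact (Finset.mem_filter.1 hσ).2.inv a
  · intro h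
    exact absurd (Finset.mem_filter.2 ⟨Finset.mem_univ _, fun _ => rfl⟩) h

/-- Up to scalars, the polytabloid of `t` is the only alternating element of the tabloid module. -/
theorem Tableau.IsAlternating.eq_smul_polytabloid {t : Tableau α lam} {v : ℂ[Tabloid α lam]}
    (hv : t.IsAlternating v) : v = v.coeff t.tabloid • t.polytabloid := by
  ext T
  rw [MonoidAlgebra.coeff_smul, Finsupp.smul_apply, smul_eq_mul]
  by_cases hT : ∀ a b, (t a).1.2 = (t b).1.2 → T.1 a = T.1 b → a = b
  · obtain ⟨σ, hσ, rfl⟩ := t.exists_columnPerm T hT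
    rw [hv.coeff_smul hσ, t.isAlternating_polytabloid.coeff_smul hσ, t.polytabloid_coeff_self,
      mul_one, mul_comm]
  · push Not at hT
    obtain ⟨a, b, hcol, hab, hne⟩ := hT
    have hx : Equiv.swap a b • T = T := by
      refine Subtype.ext (funext fun c => ?_)
      change T.1 ((Equiv.swap a b)⁻¹ c) = T.1 c
      rw [Equiv.swap_inv]
      exact apply_swap_eq hab c
    rw [hv.coeff_eq_zero hne hcol hx, t.isAlternating_polytabloid.coeff_eq_zero hne hcol hx,
      mul_zero]

/-- The polytabloid of `t` as an element of the Specht module. -/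
def Tableau.spechtVector (t : Tableau α lam) : SpechtModule α lam :=
  ⟨t.polytabloid, Submodule.subset_span ⟨t, rfl⟩⟩

theorem Tableau.spechtVector_ne_zero (t : Tableau α lam) : t.spechtVector ≠ 0 := by
  intro h
  have h1 : t.polytabloid = 0 := congrArg Subtype.val h
  have h2 := t.polytabloid_coeff_self
  rw [h1] at h2
  simp at h2

variable {V : Type} [AddCommGroup V] [Module ℂ V] {ρ : Representation ℂ (Equiv.Perm α) V}

/-- The Specht module is generated by any one polytabloid. -/
theorem Tableau.intertwiningMap_ext (t : Tableau α lam)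
    {f g : Representation.IntertwiningMap (specht α lam) ρ}
    (h : f t.spechtVector = g t.spechtVector) : f = g := by
  refine DFunLike.ext f g ?_
  rintro ⟨x, hx⟩
  induction hx using Submodule.span_induction with
  | mem x hx =>
    obtain ⟨t', rfl⟩ := hx
    let τ : Equiv.Perm α := t.trans t'.symm
    have h1 : (⟨t'.polytabloid, Submodule.subset_span ⟨t', rfl⟩⟩ : SpechtModule α lam) =
        specht α lam τ t.spechtVector := by
      refine Subtype.ext ?_
      change t'.polytabloid = Representation.ofMulAction ℂ (Equiv.Perm α) (Tabloid α lam) τ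
        t.polytabloid
      rw [t.smul_polytabloid]
      exact congrArg Tableau.polytabloid
        (Equiv.ext fun a => (t.apply_symm_apply (t' a)).symm)
    rw [h1, f.isIntertwining, g.isIntertwining, h]
  | zero => exact (map_zero f).trans (map_zero g).symm
  | add x y hx hy ihx ihy =>
    exact (map_add f ⟨x, hx⟩ ⟨y, hy⟩).trans ((congrArg₂ _ ihx ihy).trans
      (map_add g ⟨x, hx⟩ ⟨y, hy⟩).symm)
  | smul c x hx ih =>
    exact (map_smul f c ⟨x, hx⟩).trans ((congrArg _ ih).trans (map_smul g c ⟨x, hx⟩).symm)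

theorem Tableau.isAlternating_apply (t : Tableau α lam) {X : Type} [MulAction (Equiv.Perm α) X]
    (f : Representation.IntertwiningMap (specht α lam)
      (Representation.ofMulAction ℂ (Equiv.Perm α) X)) :
    t.IsAlternating (f t.spechtVector) := by
  intro σ hσ
  rw [← f.isIntertwining, ← map_smul]
  exact congrArg f (Subtype.ext (t.isAlternating_polytabloid σ hσ))

/-- The inclusion of the Specht module into the module of tabloids. -/
def spechtInclusion (α : Type) [Fintype α] [DecidableEq α] (lam : YoungDiagram) :
    Representation.IntertwiningMap (specht α lam)
      (Representation.ofMulAction ℂ (Equiv.Perm α) (Tabloid α lam)) :=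
  ⟨(spechtSub α lam).toSubmodule.subtype, fun _ => rfl⟩

theorem Tableau.finrank_hom_tabloid (t : Tableau α lam) :
    Module.finrank ℂ (Representation.IntertwiningMap (specht α lam)
      (Representation.ofMulAction ℂ (Equiv.Perm α) (Tabloid α lam))) = 1 := by
  refine finrank_eq_one (spechtInclusion α lam) (fun h => ?_) fun f =>
    ⟨(f t.spechtVector).coeff t.tabloid, t.intertwiningMap_ext ?_⟩
  · exact t.spechtVector_ne_zero (Subtype.ext (DFunLike.congr_fun h t.spechtVector))
  · exact (t.isAlternating_apply f).eq_smul_polytabloid.symm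

theorem Tableau.finrank_end (t : Tableau α lam) :
    Module.finrank ℂ (Representation.IntertwiningMap (specht α lam) (specht α lam)) = 1 := by
  refine finrank_eq_one (Representation.IntertwiningMap.id _) (fun h => ?_) fun f =>
    ⟨((spechtInclusion α lam).comp f t.spechtVector).coeff t.tabloid,
      t.intertwiningMap_ext (Subtype.ext ?_)⟩
  · exact t.spechtVector_ne_zero (DFunLike.congr_fun h t.spechtVector)
  · exact (t.isAlternating_apply ((spechtInclusion α lam).comp f)).eq_smul_polytabloid.symm

/-- The Specht module does not map to a permutation module in which every point is fixed by a
transposition from the column stabiliser. -/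
theorem Tableau.finrank_hom_eq_zero (t : Tableau α lam) {X : Type} [MulAction (Equiv.Perm α) X]
    (hX : ∀ x : X, ∃ a b, a ≠ b ∧ (t a).1.2 = (t b).1.2 ∧ Equiv.swap a b • x = x) :
    Module.finrank ℂ (Representation.IntertwiningMap (specht α lam)
      (Representation.ofMulAction ℂ (Equiv.Perm α) X)) = 0 := by
  have : Subsingleton (Representation.IntertwiningMap (specht α lam)
      (Representation.ofMulAction ℂ (Equiv.Perm α) X)) := by
    refine ⟨fun f g => t.intertwiningMap_ext ?_⟩
    have h : ∀ f : Representation.IntertwiningMap (specht α lam)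
        (Representation.ofMulAction ℂ (Equiv.Perm α) X), f t.spechtVector = 0 := by
      intro f
      ext x
      obtain ⟨a, b, hne, hcol, hx⟩ := hX x
      exact (t.isAlternating_apply f).coeff_eq_zero hne hcol hx
    rw [h f, h g]
  exact Module.finrank_zero_of_subsingleton

end Specht

/-! ### Frobenius' formula for Specht modules, and Pieri's rule -/

section SpechtCharacter

theorem Tabloid.apply_lt {α : Type} [Finite α] {lam : YoungDiagram} (T : Tabloid α lam) (a : α) :
    T.1 a < lam.colLen 0 := by
  by_contra! h
  have h1 := T.2 (T.1 a)
  rw [rowLen_eq_zero h] at h1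
  have : Nonempty {b // T.1 b = T.1 a} := ⟨⟨a, rfl⟩⟩
  exact Nat.card_pos.ne' h1

/-- Tabloids of shape `λ` are the labellings of content `λ`, by any set of labels that contains the
row indices. -/
def tabloidEquivFill (α : Type) [Fintype α] {lam : YoungDiagram} {N : ℕ}
    (hN : lam.colLen 0 ≤ N) :
    Tabloid α lam ≃ Fill α (expo fun i : Fin N => lam.rowLen i) where
  toFun T := ⟨fun a => ⟨T.1 a, (T.apply_lt a).trans_le hN⟩, Finsupp.ext fun i => by
    classical
    rw [content_apply, ← Nat.card_eq_fintype_card]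
    refine Eq.trans (Nat.card_congr (Equiv.subtypeEquivRight fun a => ?_)) (T.2 i)
    rw [Fin.ext_iff]⟩
  invFun F := ⟨fun a => F.1 a, fun i => by
    classical
    by_cases hi : i < N
    · have h := DFunLike.congr_fun F.2 ⟨i, hi⟩
      rw [content_apply, ← Nat.card_eq_fintype_card] at h
      refine Eq.trans (Nat.card_congr (Equiv.subtypeEquivRight fun a => ?_)) h
      rw [Fin.ext_iff]
    · rw [rowLen_eq_zero (hN.trans (not_lt.1 hi))]
      have : IsEmpty {a // (F.1 a : ℕ) = i} := ⟨fun a => hi (a.2 ▸ (F.1 a.1).2)⟩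
      exact Nat.card_of_isEmpty⟩
  left_inv _ := rfl
  right_inv _ := rfl

instance (α : Type) [Finite α] (lam : YoungDiagram) : Finite (Tabloid α lam) :=
  have := Fintype.ofFinite α
  Finite.of_equiv _ (tabloidEquivFill α (le_refl (lam.colLen 0))).symm

instance (X : Type) [Finite X] : FiniteDimensional ℂ ℂ[X] :=
  Module.Finite.equiv (MonoidAlgebra.coeffLinearEquiv ℂ).symm

theorem Fill.sum_val {α : Type} [Fintype α] {N : ℕ} {c : Fin N →₀ ℕ} (F : Fill α c) :
    ∑ a, (F.1 a : ℕ) = ∑ i : Fin N, (i : ℕ) * c i := by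
  rw [← Finset.sum_fiberwise Finset.univ F.1]
  refine Finset.sum_congr rfl fun i _ => ?_
  rw [Finset.sum_congr rfl (g := fun _ => (i : ℕ))
    (fun a ha => by rw [(Finset.mem_filter.1 ha).2]), Finset.sum_const, smul_eq_mul, mul_comm,
    ← Fintype.card_subtype, ← content_apply, F.2]

variable {α : Type} [Fintype α] [DecidableEq α] {lam : YoungDiagram} {N : ℕ}

theorem natCard_fixedBy_tabloid (hN : lam.colLen 0 ≤ N) (g : Equiv.Perm α) :
    Nat.card (MulAction.fixedBy (Tabloid α lam) g) =
      fixedCount (expo fun i : Fin N => lam.rowLen i) g := by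
  rw [← natCard_fixedBy]
  refine Nat.card_congr ((tabloidEquivFill α hN).subtypeEquiv fun T => ?_)
  rw [MulAction.mem_fixedBy, MulAction.mem_fixedBy, ← (tabloidEquivFill α hN).injective.eq_iff]
  rfl

theorem sum_fixedCount_mul_character (c : Fin N →₀ ℕ) :
    ∑ g : Equiv.Perm α, (fixedCount c g : ℂ) * (specht α lam).character g⁻¹ =
      (Fintype.card α).factorial * Module.finrank ℂ (Representation.IntertwiningMap (specht α lam)
        (Representation.ofMulAction ℂ (Equiv.Perm α) (Fill α c))) := by
  rw [← Fintype.card_perm, ← finrank_intertwiningMap_eq]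
  exact Finset.sum_congr rfl fun g _ => by rw [character_ofMulAction, natCard_fixedBy]

theorem Tableau.sum_fixedCount_rowLen_mul_character (t : Tableau α lam) (hN : lam.colLen 0 ≤ N) :
    ∑ g : Equiv.Perm α, (fixedCount (expo fun i : Fin N => lam.rowLen i) g : ℂ) *
      (specht α lam).character g⁻¹ = (Fintype.card α).factorial := by
  have h := finrank_intertwiningMap_eq (specht α lam)
    (Representation.ofMulAction ℂ (Equiv.Perm α) (Tabloid α lam))
  rw [t.finrank_hom_tabloid, Nat.cast_one, mul_one, Fintype.card_perm] at h
  rw [← h]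
  exact Finset.sum_congr rfl fun g _ => by
    rw [character_ofMulAction, natCard_fixedBy_tabloid hN]

/-- A content whose weighted sum is smaller than that of `λ` does not occur in the Specht module
of `λ`. -/
theorem Tableau.finrank_hom_fill_eq_zero (t : Tableau α lam) (hN : lam.colLen 0 ≤ N)
    {c : Fin N →₀ ℕ} (hc : ∑ i : Fin N, (i : ℕ) * c i < ∑ i : Fin N, (i : ℕ) * lam.rowLen i) :
    Module.finrank ℂ (Representation.IntertwiningMap (specht α lam)
      (Representation.ofMulAction ℂ (Equiv.Perm α) (Fill α c))) = 0 := by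
  refine t.finrank_hom_eq_zero fun F => ?_
  have ht : ∑ a, (t a).1.1 = ∑ i : Fin N, (i : ℕ) * lam.rowLen i :=
    Fill.sum_val (tabloidEquivFill α hN t.tabloid)
  by_contra! hF
  have hinj : ∀ a b, (t a).1.2 = (t b).1.2 → (F.1 a : ℕ) = F.1 b → a = b := by
    intro a b hcol hab
    by_contra hne
    refine hF a b hne hcol (Subtype.ext (funext fun d => ?_))
    rw [Fill.smul_apply, Equiv.swap_inv]
    exact apply_swap_eq (Fin.ext hab) d
  have hle := (t.row_weight hinj).1
  rw [ht, F.sum_val] at hle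
  exact absurd hc (not_lt.2 hle)

/-- The rearrangement inequality for `i` and `N - 1 - i`, from `∑ (i - σ i) ^ 2 > 0`. -/
theorem sum_mul_stair_lt {σ : Equiv.Perm (Fin N)} (hσ : σ ≠ 1) :
    ∑ i : Fin N, (i : ℕ) * stair i < ∑ i : Fin N, (i : ℕ) * stair (σ i) := by
  have hpos : 0 < ∑ i : Fin N, ((i : ℤ) - σ i) ^ 2 := by
    refine Finset.sum_pos' (fun i _ => sq_nonneg _) ?_
    obtain ⟨i, hi⟩ : ∃ i, σ i ≠ i := by
      by_contra! h
      exact hσ (Equiv.ext h)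
    refine ⟨i, Finset.mem_univ i, ?_⟩
    have : (i : ℤ) - σ i ≠ 0 := by
      intro h
      exact hi (Fin.ext (by omega))
    positivity
  have hsq : ∑ i : Fin N, ((σ i : ℕ) : ℤ) ^ 2 = ∑ i : Fin N, ((i : ℕ) : ℤ) ^ 2 :=
    Equiv.sum_comp σ fun i : Fin N => ((i : ℕ) : ℤ) ^ 2
  have hst : ∀ i : Fin N, ((stair i : ℕ) : ℤ) = N - 1 - i := by
    intro i
    have := i.2
    simp only [stair, Fin.val_rev]
    omega
  zify
  simp only [hst, mul_sub, Finset.sum_sub_distrib, sub_sq, Finset.sum_add_distrib] at hpos ⊢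
  have h2 : ∑ i : Fin N, 2 * ((i : ℕ) : ℤ) * ((σ i : ℕ) : ℤ) =
      2 * ∑ i : Fin N, ((i : ℕ) : ℤ) * ((σ i : ℕ) : ℤ) := by
    rw [Finset.mul_sum]; exact Finset.sum_congr rfl fun i _ => by ring
  have h3 : ∑ i : Fin N, ((i : ℕ) : ℤ) * ((i : ℕ) : ℤ) = ∑ i : Fin N, ((i : ℕ) : ℤ) ^ 2 :=
    Finset.sum_congr rfl fun i _ => by ring
  rw [hsq, h2] at hpos
  rw [h3]
  linarith

/-- Frobenius' class function and the Specht character have scalar product one: in the alternating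
sum only the term of the identity contributes. -/
theorem Tableau.sum_frobeniusChar_mul_character (t : Tableau α lam) (hN : lam.colLen 0 ≤ N) :
    ∑ g : Equiv.Perm α, frobeniusChar (shifted N lam) g * (specht α lam).character g⁻¹ =
      (Fintype.card α).factorial := by
  simp only [frobeniusChar_eq_sum, Finset.sum_mul]
  rw [Finset.sum_comm, Finset.sum_eq_single 1]
  · rw [← t.sum_fixedCount_rowLen_mul_character hN]
    refine Finset.sum_congr rfl fun g _ => ?_
    have h1 : (fun i : Fin N => shifted N lam i - stair ((1 : Equiv.Perm (Fin N)) i)) =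
        fun i : Fin N => lam.rowLen i := funext fun i => Nat.add_sub_cancel _ _
    rw [if_pos (show ∀ i, stair ((1 : Equiv.Perm (Fin N)) i) ≤ shifted N lam i from
      fun i => Nat.le_add_left _ _), h1]
    simp
  · intro σ _ hσ
    by_cases hle : ∀ i, stair (σ i) ≤ shifted N lam i
    · have hlt : ∑ i : Fin N, (i : ℕ) * (expo fun i => shifted N lam i - stair (σ i)) i <
          ∑ i : Fin N, (i : ℕ) * lam.rowLen i := by
        have h1 : ∑ i : Fin N, (i : ℕ) * (shifted N lam i - stair (σ i)) +
            ∑ i : Fin N, (i : ℕ) * stair (σ i) =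
              ∑ i : Fin N, (i : ℕ) * lam.rowLen i + ∑ i : Fin N, (i : ℕ) * stair i := by
          rw [← Finset.sum_add_distrib, ← Finset.sum_add_distrib]
          refine Finset.sum_congr rfl fun i _ => ?_
          rw [← mul_add, ← mul_add, Nat.sub_add_cancel (hle i)]
          rfl
        have h2 := sum_mul_stair_lt hσ
        simp only [Finsupp.coe_equivFunOnFinite_symm]
        omega
      have h := sum_fixedCount_mul_character (α := α) (lam := lam)
        (expo fun i => shifted N lam i - stair (σ i))
      rw [t.finrank_hom_fill_eq_zero hN hlt, Nat.cast_zero, mul_zero] at h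
      rw [← mul_zero ((Equiv.Perm.sign σ : ℤ) : ℂ), ← h, Finset.mul_sum]
      refine Finset.sum_congr rfl fun g _ => ?_
      rw [if_pos hle, mul_assoc]
    · refine Finset.sum_eq_zero fun g _ => ?_
      rw [if_neg hle, mul_zero, zero_mul]
  · simp

/-- Frobenius' character formula for Specht modules: two class functions of norm one and scalar
product one agree. -/
theorem Tableau.character_specht (t : Tableau α lam) (hN : lam.colLen 0 ≤ N) (g : Equiv.Perm α) :
    (specht α lam).character g = frobeniusChar (shifted N lam) g := by
  have hcard : Fintype.card α = lam.card := by simpa using Fintype.card_congr t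
  have hee := sum_frobeniusChar_mul_self (α := α) (e := shifted N lam)
    (shifted_strictAnti lam).injective (by rw [sum_shifted hN, hcard])
  have hec := t.sum_frobeniusChar_mul_character hN
  have hcc := finrank_intertwiningMap_eq (specht α lam) (specht α lam)
  rw [t.finrank_end, Nat.cast_one, mul_one, Fintype.card_perm] at hcc
  have hce : ∑ g : Equiv.Perm α, (specht α lam).character g * frobeniusChar (shifted N lam) g =
      (Fintype.card α).factorial := by
    have h := congrArg (starRingEnd ℂ) hec
    simp only [map_sum, map_mul, character_inv, conj_frobeniusChar, Complex.conj_conj,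
      map_natCast] at h
    rw [← h]
    exact Finset.sum_congr rfl fun g _ => mul_comm _ _
  -- The squared distance of the two class functions is `1 - 1 - 1 + 1`.
  have hsum : ∑ g : Equiv.Perm α,
      ((Complex.normSq ((specht α lam).character g - frobeniusChar (shifted N lam) g) : ℝ) : ℂ) =
        0 := by
    simp only [← Complex.mul_conj, map_sub, conj_frobeniusChar, ← character_inv]
    simp only [sub_mul, mul_sub, Finset.sum_sub_distrib]
    rw [hcc, hce, hec, hee]
    ring
  rw [← Complex.ofReal_sum, Complex.ofReal_eq_zero,
    Finset.sum_eq_zero_iff_of_nonneg fun g _ => Complex.normSq_nonneg _] at hsum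
  exact sub_eq_zero.1 (Complex.normSq_eq_zero.1 (hsum g (Finset.mem_univ g)))

/-- The Specht module of a single row is the trivial representation. -/
theorem Tableau.character_specht_oneRow {k : ℕ} (t : Tableau α (oneRow k)) (g : Equiv.Perm α) :
    (specht α (oneRow k)).character g = 1 := by
  have hsub : Subsingleton (Tabloid α (oneRow k)) := by
    refine ⟨fun T T' => Subtype.ext (funext fun a => ?_)⟩
    have h : (oneRow k).colLen 0 ≤ 1 := colLen_ofRowLens_le _ _
    have h1 := T.apply_lt a
    have h2 := T'.apply_lt a
    omega
  have hid : specht α (oneRow k) g = LinearMap.id := by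
    refine LinearMap.ext fun v => Subtype.ext ?_
    change Representation.ofMulAction ℂ (Equiv.Perm α) (Tabloid α (oneRow k)) g v.1 = v.1
    ext T
    rw [Representation.coeff_ofMulAction, Subsingleton.elim (g⁻¹ • T) T]
  have hrank : Module.finrank ℂ (SpechtModule α (oneRow k)) = 1 := by
    refine finrank_eq_one t.spechtVector t.spechtVector_ne_zero fun w =>
      ⟨w.1.coeff t.tabloid, Subtype.ext ?_⟩
    change w.1.coeff t.tabloid • t.polytabloid = w.1
    ext T
    rw [Subsingleton.elim T t.tabloid, MonoidAlgebra.coeff_smul, Finsupp.smul_apply,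
      t.polytabloid_coeff_self, smul_eq_mul, mul_one]
  rw [Representation.character, hid, LinearMap.trace_id, hrank, Nat.cast_one]

end SpechtCharacter

section PieriRule

theorem exists_tableau {lam : YoungDiagram} {n : ℕ} (h : n = lam.card) :
    Nonempty (Tableau (Fin n) lam) :=
  ⟨Fintype.equivOfCardEq (by simpa using h)⟩

/-- Frobenius reciprocity expresses the coefficient as a scalar product of characters on the Young
subgroup. -/
theorem lrCoeff_mul_factorial {nu lam mu : YoungDiagram} :
    (lrCoeff nu lam mu : ℂ) * (lam.card.factorial * mu.card.factorial) =
      ∑ g : Equiv.Perm (Fin lam.card), ∑ h : Equiv.Perm (Fin mu.card),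
        (specht (Fin (lam.card + mu.card)) nu).character (youngEmbedding lam.card mu.card (g, h)) *
          ((specht (Fin lam.card) lam).character g⁻¹ *
            (specht (Fin mu.card) mu).character h⁻¹) := by
  have h := finrank_intertwiningMap_eq
    (V := SpechtModule (Fin lam.card) lam ⊗[ℂ] SpechtModule (Fin mu.card) mu)
    (extTensor (specht (Fin lam.card) lam) (specht (Fin mu.card) mu))
    ((specht (Fin (lam.card + mu.card)) nu).comp (youngEmbedding lam.card mu.card))
  rw [lrCoeff, multiplicity, finrank_intertwiningMap_ind, mul_comm]
  rw [Fintype.card_prod, Fintype.card_perm, Fintype.card_perm, Fintype.card_fin,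
    Fintype.card_fin, Nat.cast_mul] at h
  rw [← h, Fintype.sum_prod_type]
  refine Finset.sum_congr rfl fun g _ => Finset.sum_congr rfl fun k _ => ?_
  rw [extTensor, Representation.char_tensor]
  rfl

theorem IsHorizontalStrip.card_le {lam nu : YoungDiagram} (h : IsHorizontalStrip lam nu) :
    lam.card ≤ nu.card := by
  refine Finset.card_le_card fun c hc => ?_
  exact YoungDiagram.mem_iff_lt_rowLen.2
    ((YoungDiagram.mem_iff_lt_rowLen.1 hc).trans_le (h c.1).1)

open scoped Classical in
theorem lrCoeff_oneRow_of_card_eq {nu lam : YoungDiagram} {k : ℕ} (h : lam.card + k = nu.card) :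
    lrCoeff nu lam (oneRow k) = if IsHorizontalStrip lam nu then 1 else 0 := by
  set N := max (nu.colLen 0) (lam.colLen 0)
  have hnu : nu.colLen 0 ≤ N := le_max_left _ _
  have hlam : lam.colLen 0 ≤ N := le_max_right _ _
  obtain ⟨tnu⟩ := exists_tableau (lam := nu) (n := lam.card + (oneRow k).card)
    (by rw [card_oneRow, h])
  obtain ⟨tlam⟩ := exists_tableau (lam := lam) rfl
  obtain ⟨tk⟩ := exists_tableau (lam := oneRow k) rfl
  have key := lrCoeff_mul_factorial (nu := nu) (lam := lam) (mu := oneRow k)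
  have hterm : ∀ (g : Equiv.Perm (Fin lam.card)) (k' : Equiv.Perm (Fin (oneRow k).card)),
      (specht (Fin (lam.card + (oneRow k).card)) nu).character
          (youngEmbedding lam.card (oneRow k).card (g, k')) *
        ((specht (Fin lam.card) lam).character g⁻¹ *
          (specht (Fin (oneRow k).card) (oneRow k)).character k'⁻¹) =
      (alternant stair * (MvPolynomial.C (frobeniusChar (shifted N lam) g) *
        permPoly (Fin N) g) * permPoly (Fin N) k').coeff (expo (shifted N nu)) := by
    intro g k'
    rw [tnu.character_specht hnu, tlam.character_specht hlam, tk.character_specht_oneRow,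
      frobeniusChar_inv, mul_one, frobeniusChar]
    have hy : permPoly (Fin N) (youngEmbedding lam.card (oneRow k).card (g, k')) =
        permPoly (Fin N) g * permPoly (Fin N) k' := permPoly_sumCongr finSumFinEquiv g k'
    rw [hy, mul_comm, ← MvPolynomial.coeff_C_mul]
    congr 1
    ring
  simp only [hterm] at key
  simp only [← MvPolynomial.coeff_sum, ← Finset.mul_sum, ← Finset.sum_mul] at key
  rw [alternant_stair_mul_sum_frobeniusChar (by rw [sum_shifted hlam, Fintype.card_fin]),
    sum_permPoly, mul_mul_mul_comm, ← Nat.cast_mul (α := MvPolynomial (Fin N) ℂ),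
    ← map_natCast (MvPolynomial.C (R := ℂ) (σ := Fin N)), MvPolynomial.coeff_C_mul,
    Fintype.card_fin, Fintype.card_fin,
    coeff_alternant_mul_completeHom (shifted_strictAnti nu) (shifted_strictAnti lam)
      (by rw [sum_shifted hnu, sum_shifted hlam, card_oneRow, ← h]; ring),
    Nat.cast_mul, mul_comm] at key
  have h0 : (lam.card.factorial : ℂ) * (oneRow k).card.factorial ≠ 0 :=
    mul_ne_zero (Nat.cast_ne_zero.2 (Nat.factorial_ne_zero _))
      (Nat.cast_ne_zero.2 (Nat.factorial_ne_zero _))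
  have h1 := mul_left_cancel₀ h0 key
  rw [if_congr (isHorizontalStrip_iff_shifted hnu hlam) rfl rfl]
  split_ifs at h1 ⊢ <;> exact_mod_cast h1

open scoped Classical in
/-- **Pieri's rule**. -/
theorem lrCoeff_oneRow (nu lam : YoungDiagram) :
    lrCoeff nu lam (oneRow (nu.card - lam.card)) = if IsHorizontalStrip lam nu then 1 else 0 := by
  by_cases h : lam.card ≤ nu.card
  · exact lrCoeff_oneRow_of_card_eq (Nat.add_sub_cancel' h)
  · rw [lrCoeff_eq_zero, if_neg fun hs => h hs.card_le]
    rw [card_oneRow]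
    omega

end PieriRule

end LRFlip

end

theorem mainTheorem7 (lam xi : YoungDiagram) (n : ℕ) :
    (∀ h : lam.card + lam.rowLen 0 ≤ n,
      LRFlip.lrCoeff (LRFlip.padded lam n h) xi (LRFlip.oneRow (n - xi.card)) = 1 →
        LRFlip.lrCoeff xi lam (LRFlip.oneRow (xi.card - lam.card)) = 1) ∧
    (lam.card + xi.rowLen 0 ≤ n →
      LRFlip.lrCoeff xi lam (LRFlip.oneRow (xi.card - lam.card)) = 1 →
        ∃ h : lam.card + lam.rowLen 0 ≤ n,
          LRFlip.lrCoeff (LRFlip.padded lam n h) xi (LRFlip.oneRow (n - xi.card)) = 1) ∧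
    (lam.card + xi.rowLen 0 ≤ n →
      ∀ h : lam.card + lam.rowLen 0 ≤ n,
        LRFlip.lrCoeff xi lam (LRFlip.oneRow (xi.card - lam.card)) =
          LRFlip.lrCoeff (LRFlip.padded lam n h) xi (LRFlip.oneRow (n - xi.card))) := by
  classical
  have hpad : ∀ h : lam.card + lam.rowLen 0 ≤ n,
      LRFlip.lrCoeff (LRFlip.padded lam n h) xi (LRFlip.oneRow (n - xi.card)) =
        if LRFlip.IsHorizontalStrip lam xi ∧ lam.card + xi.rowLen 0 ≤ n then 1 else 0 := by
    intro h
    have h1 := LRFlip.lrCoeff_oneRow (LRFlip.padded lam n h) xi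
    rw [LRFlip.card_padded] at h1
    rw [h1]
    exact if_congr (LRFlip.isHorizontalStrip_padded_iff lam xi n h) rfl rfl
  simp only [hpad, LRFlip.lrCoeff_oneRow]
  refine ⟨fun _ hs => ?_, fun hxi hs => ?_, fun hxi _ => ?_⟩
  · rw [if_pos (by by_contra hn; simp [hn] at hs)]
  · have hstrip : LRFlip.IsHorizontalStrip lam xi := by by_contra hn; simp [hn] at hs
    have h0 := (hstrip 0).1
    exact ⟨by omega, if_pos ⟨hstrip, hxi⟩⟩
  · simp [hxi]
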